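/- Let $K$ be a field and let $R_*=K\langle x_1,\dots,x_n,\partial\rangle$ be a $G$-algebra: writing $x_{n+1}=\partial$, it is the quotient of the free associative algebra by relations $x_jx_i=c_{ij}x_ix_j+d_{ij}$ ($1\le i<j\le n+1$, $c_{ij}\in K^*$, $d_{ij}$ a $K$-linear combination of standard monomials $x_1^{a_1}\cdots x_n^{a_n}\partial^{\beta}$), such that for all $i<j<k$ the expression $$c_{ik}c_{jk}d_{ij}x_k-x_kd_{ij}+c_{jk}x_jd_{ik}-c_{ij}d_{ik}x_j+d_{jk}x_i-c_{ij}c_{ik}x_id_{jk}$$ reduces to zero under the rewriting rules $x_jx_i\to c_{ij}x_ix_j+d_{ij}$, and such that an admissible ordering exists, i.e. a monomial well-ordering on $K[x_1,\dots,x_{n+1}]$ with $\mathrm{lm}(d_{ij})\prec x_ix_j$ whenever $i<j$ and $d_{ij}\neq0$. Fix an admissible ordering $\prec$ for which $\partial$ is bigger than every monomial not involving $\partial$. Let $A_*\subset R_*$ be the subalgebra generated by $x_1,\dots,x_n$, suppose that $A_*\setminus\{0\}$ is a (left) Ore set in $R_*$, and let $R=(A_*\setminus\{0\})^{-1}R_*$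 (an Ore-localized $G$-algebra that is a Euclidean domain). The monomials $x^a\partial^\beta e_k$ of $R_*^{1\times p}$ are ordered position-over-term: $re_i<_*se_j$ iff $i<j$, or $i=j$ and $r\prec s$. For a nonzero row $v\in R_*^{1\times p}$ let $\mathrm{lm}(v)=x^a\partial^\beta e_k$ be its largest monomial, $\mathrm{lpos}(v)=k$ and $\deg(v)=\beta$. A finite set $G$ of nonzero elements of a left submodule $L\subseteq R_*^{1\times p}$ is called a reduced Gröbner basis of $L$ if for every nonzero $f\in L$ some $g\in G$ has $\mathrm{lm}(g)\mid\mathrm{lm}(f)$ (same position, componentwise comparison of exponents), and no monomial occurring in an element $g\in G$ is divisible by $\mathrm{lm}(h)$ for any $h\in G\setminus\{g\}$; the leading coefficients may, but need not, be normalised to $1$. Let $M\in R^{p\times p}$ have full rank, i.e. its rows are left linearly independent over $R$, and let ${}_RM=R^{1\times p}M$. Let $M_*=TM\in R_*^{p\times p}$, where $T$ is a diagonal matrix with nonzero diagonal entries in $A_*$, let ${}_{R_*}M_*$ be the left $R_*$-module generated by the rows of $M_*$, and let $\mathcal G$ be a reduced Gröbner basis of ${}_{R_*}M_*$. For $1\le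 i\le p$ let $\mathcal G_i=\{b\in\mathcal G:\mathrm{lpos}(b)=i\}$ (the $i$-th block) and let $\alpha_i$ be the degree of the smallest leading monomial of elements of $\mathcal G_i$. Then for each $1\le i\le p$ the block $\mathcal G_i$ is nonempty, $\alpha_i=\min\{\deg(b):b\in\mathcal G_i\}$, and there is exactly one element $b_i$ with the smallest leading monomial in $\{b\in\mathcal G_i:\deg(b)=\alpha_i\}$. The elements $b_1,\dots,b_p$ generate the left $R$-module ${}_RM$: $${}_R\langle b_1,\dots,b_p\rangle={}_RM .$$ Moreover, the set $\{b_1,\dots,b_p\}$ is the set of all boxed elements of $\mathcal G$, i.e. of those having the smallest leading monomial in their block. When the elements of $\mathcal G$ are written as the rows of a matrix by increasing leading monomial, this matrix is block triangular (the nonempty blocks $\mathcal G_1,\dots,\mathcal G_p$ follow each other from top to bottom, and every row in $\mathcal G_i$ has a nonzero entry in column $i$ and zeros to the right of it), and $b_1,\dots,b_p$ are exactly the top rows of its blocks. -/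

import Mathlib

/-- Data of a presentation of a `G`-algebra in the variables `x_0, …, x_{N-1}`: nonzero scalars
`c i j` and polynomials `d i j`, given in terms of standard monomials. Only the values with `i < j`
are ever used. -/
structure GPresentation (K : Type*) [Field K] (N : ℕ) where
  c : Fin N → Fin N → Kˣ
  d : Fin N → Fin N → MvPolynomial (Fin N) K

namespace GPresentation

noncomputable section

variable {K : Type*} [Field K] {N : ℕ}

/-- The variable `x_i` in the free associative algebra. -/
abbrev fx (K : Type*) [Field K] {N : ℕ} (i : Fin N) : FreeAlgebra K (Fin N) := FreeAlgebra.ι K i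

/-- The word `w`, as an element of the free associative algebra. -/
def word (K : Type*) [Field K] {N : ℕ} (w : FreeMonoid (Fin N)) : FreeAlgebra K (Fin N) :=
  FreeMonoid.lift (fx K) w

/-- The coefficient of the word `w` in an element of the free associative algebra. -/
def wordCoeff (f : FreeAlgebra K (Fin N)) (w : FreeMonoid (Fin N)) : K :=
  (FreeAlgebra.equivMonoidAlgebraFreeMonoid f).coeff w

/-- The standard monomial `x_0 ^ a_0 * x_1 ^ a_1 * ⋯ * x_{N-1} ^ a_{N-1}` in the free algebra. -/
def stdMonomial (K : Type*) [Field K] {N : ℕ} (a : Fin N →₀ ℕ) : FreeAlgebra K (Fin N) :=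
  (List.ofFn fun i => fx K i ^ a i).prod

/-- The linear combination of standard monomials with the coefficients of the polynomial `P`. -/
def std (P : MvPolynomial (Fin N) K) : FreeAlgebra K (Fin N) :=
  ∑ a ∈ P.support, P.coeff a • stdMonomial K a

/-- The element `x_j x_i - c_{ij} x_i x_j - d_{ij}` of the free algebra (used for `i < j`). -/
def relator (D : GPresentation K N) (i j : Fin N) : FreeAlgebra K (Fin N) :=
  fx K j * fx K i - (D.c i j : K) • (fx K i * fx K j) - std (D.d i j)

/-- One reduction step of the rewriting system `x_j x_i → c_{ij} x_i x_j + d_{ij}` (`i < j`):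
one word `u x_j x_i v` that occurs in `f` is rewritten. -/
def ReducesStep (D : GPresentation K N) (f g : FreeAlgebra K (Fin N)) : Prop :=
  ∃ (u v : FreeMonoid (Fin N)) (i j : Fin N), i < j ∧
    wordCoeff f (u * FreeMonoid.of j * FreeMonoid.of i * v) ≠ 0 ∧
    g = f - wordCoeff f (u * FreeMonoid.of j * FreeMonoid.of i * v) •
      (word K u * D.relator i j * word K v)

/-- `f` can be reduced to zero in finitely many steps. -/
def ReducesToZero (D : GPresentation K N) (f : FreeAlgebra K (Fin N)) : Prop :=
  Relation.ReflTransGen D.ReducesStep f 0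

/-- The non-degeneracy expression of `i < j < k`. -/
def ndc (D : GPresentation K N) (i j k : Fin N) : FreeAlgebra K (Fin N) :=
  ((D.c i k : K) * (D.c j k : K)) • (std (D.d i j) * fx K k) - fx K k * std (D.d i j)
    + (D.c j k : K) • (fx K j * std (D.d i k)) - (D.c i j : K) • (std (D.d i k) * fx K j)
    + std (D.d j k) * fx K i - ((D.c i j : K) * (D.c i k : K)) • (fx K i * std (D.d j k))

/-- The monomial (well-)ordering `m` is admissible: `lm (d_{ij}) ≺ x_i x_j` if `d_{ij} ≠ 0`. -/
def IsAdmissible (D : GPresentation K N) (m : MonomialOrder (Fin N)) : Prop :=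
  ∀ i j, i < j → D.d i j ≠ 0 →
    m.toSyn (m.degree (D.d i j)) < m.toSyn (Finsupp.single i 1 + Finsupp.single j 1)

/-- The presentation defines a `G`-algebra. -/
structure IsGAlgebra (D : GPresentation K N) : Prop where
  nondegenerate : ∀ i j k, i < j → j < k → D.ReducesToZero (D.ndc i j k)
  exists_admissible : ∃ m : MonomialOrder.{0, 0} (Fin N), D.IsAdmissible m

/-- The defining relations `x_j x_i = c_{ij} x_i x_j + d_{ij}` for `i < j`. -/
inductive Rel (D : GPresentation K N) : FreeAlgebra K (Fin N) → FreeAlgebra K (Fin N) → Prop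
  | mk (i j : Fin N) (h : i < j) :
      Rel D (fx K j * fx K i) ((D.c i j : K) • (fx K i * fx K j) + std (D.d i j))

/-- The algebra `K⟨x_0, …, x_{N-1} | x_j x_i = c_{ij} x_i x_j + d_{ij}, i < j⟩`. -/
abbrev Alg (D : GPresentation K N) : Type _ := RingQuot D.Rel

/-- The quotient map from the free algebra. -/
def proj (D : GPresentation K N) : FreeAlgebra K (Fin N) →ₐ[K] D.Alg := RingQuot.mkAlgHom K D.Rel

/-- The generator `x_i` of the algebra. -/
def x (D : GPresentation K N) (i : Fin N) : D.Alg := D.proj (fx K i)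

/-- The coefficients of an element of the algebra with respect to the standard monomials, collected
in a polynomial. In a `G`-algebra the standard monomials form a `K`-basis, so that this is the unique
`P` with `D.proj (std P) = f`. -/
def normalForm (D : GPresentation K N) (f : D.Alg) : MvPolynomial (Fin N) K :=
  Function.invFun (fun P : MvPolynomial (Fin N) K => D.proj (std P)) f

section ModuleMonomials

variable {q : ℕ}

/-- The monomial `x ^ a e_k` of the free module with basis `e_0, …, e_{q-1}`, as an element of the
linear order "position over term": positions are compared first, then the monomials
`x ^ a` with respect to `m`. The value `⊥` in `WithBot` is kept for the zero vector. -/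
def key (m : MonomialOrder (Fin N)) (k : Fin q) (a : Fin N →₀ ℕ) : WithBot (Fin q ×ₗ m.syn) :=
  ((toLex (k, m.toSyn a) : Fin q ×ₗ m.syn) : WithBot (Fin q ×ₗ m.syn))

/-- The leading monomial of a vector: the largest monomial that occurs in it (`⊥` for `0`). -/
def lm (D : GPresentation K N) (m : MonomialOrder (Fin N)) (v : Fin q → D.Alg) :
    WithBot (Fin q ×ₗ m.syn) :=
  Finset.univ.sup fun k => (D.normalForm (v k)).support.sup fun a => key m k a

/-- The leading position of a vector (`⊥` for `0`). -/
def lpos (D : GPresentation K N) (m : MonomialOrder (Fin N)) (v : Fin q → D.Alg) :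
    WithBot (Fin q) :=
  (D.lm m v).map fun μ => (ofLex μ).1

/-- `IsReducedGroebnerBasis D m G L`: the finite set `G` is a reduced left Gröbner basis of the
submodule `L`. The leading monomial of each nonzero element of `L` is divisible by that of an element
of `G`, and no monomial of an element of `G` is divisible by the leading monomial of another one.
It is not required that leading coefficients be normalised to `1`; normalised bases are included. -/
structure IsReducedGroebnerBasis (D : GPresentation K N) (m : MonomialOrder (Fin N))
    (G : Finset (Fin q → D.Alg)) (L : Submodule D.Alg (Fin q → D.Alg)) : Prop where
  subset : ∀ g ∈ G, g ∈ L
  ne_zero : ∀ g ∈ G, g ≠ 0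
  exists_dvd : ∀ f ∈ L, f ≠ 0 → ∃ g ∈ G, ∃ (k : Fin q) (a b : Fin N →₀ ℕ),
    D.lm m g = key m k a ∧ D.lm m f = key m k b ∧ a ≤ b
  reduced : ∀ g ∈ G, ∀ h ∈ G, h ≠ g → ∀ (k : Fin q) (a b : Fin N →₀ ℕ),
    D.lm m h = key m k a → b ∈ (D.normalForm (g k)).support → ¬ a ≤ b

/-- The block of `G` with leading position `i`. -/
def block (D : GPresentation K N) (m : MonomialOrder (Fin N)) (G : Finset (Fin q → D.Alg))
    (i : Fin q) : Set (Fin q → D.Alg) :=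
  {g | g ∈ G ∧ D.lpos m g = i}

/-- `g` is boxed: it has the smallest leading monomial among the elements of `G` with the same
leading position. -/
def IsBoxed (D : GPresentation K N) (m : MonomialOrder (Fin N)) (G : Finset (Fin q → D.Alg))
    (g : Fin q → D.Alg) : Prop :=
  g ∈ G ∧ ∀ h ∈ G, D.lpos m h = D.lpos m g → D.lm m g ≤ D.lm m h

/-- The rows of the matrix `B` are the elements of `G`, sorted by increasing leading monomial, and
`B` is block triangular: the blocks of leading positions `0, 1, …, q - 1` are nonempty and
follow each other from top to bottom, and the rows of the `i`-th block have a nonzero entry in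
column `i` and zero entries to the right of it. -/
structure IsBlockTriangularForm (D : GPresentation K N) (m : MonomialOrder (Fin N))
    (G : Finset (Fin q → D.Alg)) {l : ℕ} (B : Matrix (Fin l) (Fin q) D.Alg) : Prop where
  rows : Set.range B.row = (G : Set (Fin q → D.Alg))
  sorted : StrictMono fun r => D.lm m (B.row r)
  blocks_sorted : Monotone fun r => D.lpos m (B.row r)
  blocks_nonempty : ∀ i : Fin q, ∃ r, D.lpos m (B.row r) = i
  entry_ne_zero : ∀ (r : Fin l) (i : Fin q), D.lpos m (B.row r) = i → B r i ≠ 0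
  entry_eq_zero : ∀ (r : Fin l) (i j : Fin q), D.lpos m (B.row r) = i → i < j → B r j = 0

end ModuleMonomials

section OreLocalized

/-! In this section the `G`-algebra `R_* = D.Alg` has the variables `x_0, …, x_{n-1}` and the last
variable `∂`. -/

variable {n q : ℕ}

/-- `m` is an ordering in which `∂` is bigger than any monomial that does not involve `∂`. -/
def DelIsLarge (m : MonomialOrder (Fin (n + 1))) : Prop :=
  ∀ a : Fin (n + 1) →₀ ℕ, a (Fin.last n) = 0 →
    m.toSyn a < m.toSyn (Finsupp.single (Fin.last n) 1)

/-- The degree (in `∂`) of the leading monomial of a vector (`⊥` for `0`). -/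
def deg (D : GPresentation K (n + 1)) (m : MonomialOrder (Fin (n + 1))) (v : Fin q → D.Alg) :
    WithBot ℕ :=
  (D.lm m v).map fun μ => m.toSyn.symm (ofLex μ).2 (Fin.last n)

/-- The subalgebra `A_*` of `R_*` generated by `x_0, …, x_{n-1}`. -/
def coeffAlg (D : GPresentation K (n + 1)) : Subalgebra K D.Alg :=
  Algebra.adjoin K (Set.range fun i : Fin n => D.x i.castSucc)

/-- The multiplicative set generated by `A_* \ {0}`; as a `G`-algebra is a domain, it is
`A_* \ {0}` itself, see `mem_denominators_iff`. -/
def denominators (D : GPresentation K (n + 1)) : Submonoid D.Alg :=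
  Submonoid.closure {a | a ∈ D.coeffAlg ∧ a ≠ 0}

theorem mem_denominators_iff (D : GPresentation K (n + 1)) [Nontrivial D.Alg]
    [NoZeroDivisors D.Alg] (a : D.Alg) : a ∈ D.denominators ↔ a ∈ D.coeffAlg ∧ a ≠ 0 := by
  constructor
  · intro h
    induction h using Submonoid.closure_induction with
    | mem x hx => exact hx
    | one => exact ⟨one_mem _, one_ne_zero⟩
    | mul x y _ _ hx hy => exact ⟨mul_mem hx.1 hy.1, mul_ne_zero hx.2 hy.2⟩
  · exact fun h => Submonoid.subset_closure h

/-- The Ore localization `R = (A_* \ {0})⁻¹ R_*`, whose elements are the left fractions. -/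
abbrev OLGAED (D : GPresentation K (n + 1)) [OreLocalization.OreSet D.denominators] : Type _ :=
  OreLocalization D.denominators D.Alg

/-- The canonical map from `R_*` to `R`. -/
def toOLGAED (D : GPresentation K (n + 1)) [OreLocalization.OreSet D.denominators] (f : D.Alg) :
    D.OLGAED :=
  OreLocalization.numeratorHom f

/-- `Mstar = T * M` for a diagonal matrix `T` with nonzero diagonal entries in `A_*`, and `Mstar` has
entries in `R_*`. -/
def IsFractionFreeForm (D : GPresentation K (n + 1)) [OreLocalization.OreSet D.denominators]
    {p : ℕ} (M : Matrix (Fin p) (Fin q) D.OLGAED) (Mstar : Matrix (Fin p) (Fin q) D.Alg) : Prop :=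
  ∃ t : Fin p → D.Alg, (∀ i, t i ∈ D.coeffAlg ∧ t i ≠ 0) ∧
    Matrix.diagonal (fun i => D.toOLGAED (t i)) * M = Mstar.map D.toOLGAED

/-- `a = α_i`: it is the degree of the smallest leading monomial in the block of `i`. -/
def IsAlpha (D : GPresentation K (n + 1)) (m : MonomialOrder (Fin (n + 1)))
    (G : Finset (Fin q → D.Alg)) (i : Fin q) (a : ℕ) : Prop :=
  ∃ g ∈ D.block m G i, (∀ h ∈ D.block m G i, D.lm m g ≤ D.lm m h) ∧ D.deg m g = a

/-- `g` has the smallest leading monomial among the elements of `G` of leading position `i` and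
degree `α_i`. -/
def IsSelected (D : GPresentation K (n + 1)) (m : MonomialOrder (Fin (n + 1)))
    (G : Finset (Fin q → D.Alg)) (i : Fin q) (g : Fin q → D.Alg) : Prop :=
  ∃ a : ℕ, D.IsAlpha m G i a ∧ (g ∈ D.block m G i ∧ D.deg m g = a) ∧
    ∀ h ∈ D.block m G i, D.deg m h = a → D.lm m g ≤ D.lm m h

end OreLocalized

end

end GPresentation

/-! Over `R` the nonzero elements of `A_*` are units, so only the degree in ∂ matters, and division
with remainder is available. Let `L` be the `R_*`-module generated by the rows of `Mstar`. Suppose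
that for each position `i` it contains `b i` with leading position `i` whose `i`-th entry has the
least ∂-degree among all elements of `L` with that leading position. Dividing the last nonzero entry
of `f ∈ L` by that of `b i` lowers its ∂-degree; by minimality division stays possible until the
entry vanishes, and the argument moves one column to the left (`mapVec_mem_span_of_forall`). Since
the rows of `M` and `Mstar` differ by units of `R`, the `b i` generate the row module of `M`.

The smallest element of a block is such a `b i`. By the Gröbner property, every leading monomial of
`L` is divisible by one from the block (`IsReducedGroebnerBasis.exists_mem_block`), and since ∂
dominates the other variables, a smaller leading monomial in the same position has no larger
∂-degree (`deg_mono`). Reducedness enters only through `IsReducedGroebnerBasis.lm_injOn`, which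
gives uniqueness. Blocks are nonempty because `R_*` is a left Ore domain (`exists_mul_eq_mul`): the
`p` independent rows together with a unit vector are dependent, so `L` contains a nonzero multiple
of each unit vector (`exists_single_mem_span`).

All this rests on the standard monomials being a basis of `R_*` and on leading exponents adding
under multiplication. The first is a diamond lemma argument: by well-founded induction on words, all
reducts of a word have the same normal form. Disjoint descents commute (`nf_disjoint`); an overlap
`x_k x_j x_i` is resolved by the identity `rhs_mul_sub_mul_rhs` and the non-degeneracy condition
(`nf_overlap`). Hence `nf` descends to the quotient algebra (`nf_eq_of_proj_eq`). Each sorting step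
only multiplies the top coefficient by some `c_ij ≠ 0`, which gives `degree_normalForm_mul`. -/

namespace GPresentation

noncomputable section

variable {K : Type*} [Field K] {N : ℕ}

open Finsupp FreeMonoid

/-! ### Words and their exponents -/

/-- The exponent vector of a word. -/
def expo (w : FreeMonoid (Fin N)) : Fin N →₀ ℕ :=
  Multiplicative.toAdd (FreeMonoid.lift (fun i => Multiplicative.ofAdd (single i 1)) w)

@[simp] theorem expo_one : expo (1 : FreeMonoid (Fin N)) = 0 := by simp [expo]

@[simp] theorem expo_mul (u v : FreeMonoid (Fin N)) : expo (u * v) = expo u + expo v := by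
  simp [expo]

@[simp] theorem expo_of (i : Fin N) : expo (of i) = single i 1 := by simp [expo]

theorem expo_apply (w : FreeMonoid (Fin N)) (i : Fin N) : expo w i = w.toList.count i := by
  induction w using FreeMonoid.recOn with
  | one => simp
  | of_mul j w ih =>
    simp [ih, List.count_cons, single_apply, add_comm]

/-- The weight of a word; it drops when a descent is removed by a transposition. -/
def weightAux : List (Fin N) → ℕ
  | [] => 0
  | a :: l => (l.length + 1) * a + weightAux l

/-- The weight of a word; it drops when a descent is removed by a transposition. -/
def weight (w : FreeMonoid (Fin N)) : ℕ := weightAux w.toList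

/-- Each letter counts with its distance from the end of the word, so exchanging the adjacent
letters `j`, `i` lowers the weight by exactly `j - i`. -/
theorem weight_swap_lt (u v : FreeMonoid (Fin N)) {i j : Fin N} (h : i < j) :
    weight (u * of i * of j * v) < weight (u * of j * of i * v) := by
  have h' : (i : ℕ) < j := h
  induction u using FreeMonoid.recOn with
  | one =>
    simp only [weight, one_mul, toList_mul, toList_of, weightAux,
      List.length_cons, List.cons_append, List.nil_append]
    nlinarith
  | of_mul a u ih =>
    simp only [weight, toList_mul, toList_of, List.cons_append,
      List.nil_append, weightAux, List.append_assoc, List.length_append, List.length_cons] at ih ⊢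
    omega

@[simp] theorem word_one : word K (1 : FreeMonoid (Fin N)) = 1 := by simp [word]

@[simp] theorem word_mul (u v : FreeMonoid (Fin N)) : word K (u * v) = word K u * word K v := by
  simp [word]

@[simp] theorem word_of (i : Fin N) : word K (of i) = fx K i := by simp [word]

theorem basisFreeMonoid_apply (w : FreeMonoid (Fin N)) :
    FreeAlgebra.basisFreeMonoid K (Fin N) w = word K w := by
  simp only [FreeAlgebra.basisFreeMonoid, word]
  simp [FreeAlgebra.equivMonoidAlgebraFreeMonoid, MonoidAlgebra.lift_apply]

theorem basisFreeMonoid_repr (f : FreeAlgebra K (Fin N)) (w : FreeMonoid (Fin N)) :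
    (FreeAlgebra.basisFreeMonoid K (Fin N)).repr f w = wordCoeff f w := rfl

/-- The span of the words in a set. -/
def wordSpan (K : Type*) [Field K] {N : ℕ} (s : Set (FreeMonoid (Fin N))) :
    Submodule K (FreeAlgebra K (Fin N)) :=
  Submodule.span K (FreeAlgebra.basisFreeMonoid K (Fin N) '' s)

theorem word_mem_wordSpan {s : Set (FreeMonoid (Fin N))} {w : FreeMonoid (Fin N)} (h : w ∈ s) :
    word K w ∈ wordSpan K s :=
  Submodule.subset_span ⟨w, h, basisFreeMonoid_apply w⟩

theorem mem_of_mem_wordSpan {s : Set (FreeMonoid (Fin N))} {f : FreeAlgebra K (Fin N)}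
    (hf : f ∈ wordSpan K s) {w : FreeMonoid (Fin N)} (hw : wordCoeff f w ≠ 0) : w ∈ s := by
  rw [wordSpan, Module.Basis.mem_span_image] at hf
  exact hf (by simpa [basisFreeMonoid_repr] using hw)

theorem span_word : Submodule.span K (Set.range (word K (N := N))) = ⊤ := by
  rw [← (FreeAlgebra.basisFreeMonoid K (Fin N)).span_eq]
  congr 2
  ext1 w
  exact (basisFreeMonoid_apply w).symm

theorem eq_sum_word (f : FreeAlgebra K (Fin N)) :
    f ∈ Submodule.span K (Set.range (word K (N := N))) := by simp [span_word]

/-- The sorted word with exponents `a`. -/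
def stdWord (a : Fin N →₀ ℕ) : FreeMonoid (Fin N) := (List.ofFn fun i => of i ^ a i).prod

@[simp] theorem word_stdWord (a : Fin N →₀ ℕ) : word K (stdWord a) = stdMonomial K a := by
  simp only [stdWord, stdMonomial, word, map_list_prod, List.map_ofFn]
  congr 2
  ext1 i
  simp

@[simp] theorem expo_stdWord (a : Fin N →₀ ℕ) : expo (stdWord a) = a := by
  simp only [stdWord, expo, map_list_prod, List.map_ofFn, List.prod_ofFn, toAdd_prod]
  ext i
  simp

theorem toList_of_pow (i : Fin N) (k : ℕ) : (of i ^ k).toList = List.replicate k i := by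
  induction k with
  | zero => simp
  | succ k ih => rw [pow_succ', toList_mul, ih]; simp [List.replicate_succ]

theorem pairwise_stdWord (a : Fin N →₀ ℕ) : (stdWord a).toList.Pairwise (· ≤ ·) := by
  rw [stdWord, toList_prod, List.pairwise_flatten, List.map_ofFn, List.pairwise_ofFn]
  constructor
  · intro l hl
    obtain ⟨i, rfl⟩ := (List.mem_ofFn' _ _).1 hl
    simp [toList_of_pow, List.pairwise_replicate]
  · intro i j hij x hx y hy
    simp only [Function.comp, toList_of_pow, List.mem_replicate] at hx hy
    rw [hx.2, hy.2]
    exact hij.le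

/-- `w` has a descent. -/
def HasDescent (w : FreeMonoid (Fin N)) : Prop :=
  ∃ (u v : FreeMonoid (Fin N)) (i j : Fin N), i < j ∧ w = u * of j * of i * v

theorem not_hasDescent_iff {w : FreeMonoid (Fin N)} :
    ¬ HasDescent w ↔ w.toList.Pairwise (· ≤ ·) := by
  rw [← List.isChain_iff_pairwise, List.isChain_iff_forall_rel_of_append_cons_cons]
  constructor
  · intro h a b l₁ l₂ hl
    by_contra hab
    refine h ⟨ofList l₁, ofList l₂, b, a, not_le.1 hab, ?_⟩
    apply toList.injective
    simp [hl]
  · rintro h ⟨u, v, i, j, hij, rfl⟩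
    exact absurd (@h j i u.toList v.toList (by simp)) (not_le.2 hij)

theorem not_hasDescent_stdWord (a : Fin N →₀ ℕ) : ¬ HasDescent (stdWord a) :=
  not_hasDescent_iff.2 (pairwise_stdWord a)

theorem eq_stdWord_of_not_hasDescent {w : FreeMonoid (Fin N)} (h : ¬ HasDescent w) :
    w = stdWord (expo w) := by
  apply toList.injective
  refine List.Perm.eq_of_pairwise (fun a b _ _ => le_antisymm) (not_hasDescent_iff.1 h)
    (pairwise_stdWord _) (List.perm_iff_count.2 fun i => ?_)
  rw [← expo_apply, ← expo_apply, expo_stdWord]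

/-! ### The rewriting system -/

/-- The right hand side `c_{ij} x_i x_j + d_{ij}` of a rewriting rule. -/
def rhs (D : GPresentation K N) (i j : Fin N) : FreeAlgebra K (Fin N) :=
  (D.c i j : K) • (fx K i * fx K j) + std (D.d i j)

theorem relator_eq (D : GPresentation K N) (i j : Fin N) :
    D.relator i j = fx K j * fx K i - D.rhs i j := by
  rw [relator, rhs, sub_sub]

/-- `f` is obtained from the word `w` by applying one rewriting rule. -/
def IsReduct (D : GPresentation K N) (w : FreeMonoid (Fin N)) (f : FreeAlgebra K (Fin N)) : Prop :=
  ∃ (u v : FreeMonoid (Fin N)) (i j : Fin N), i < j ∧ w = u * of j * of i * v ∧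
    f = word K u * D.rhs i j * word K v

theorem HasDescent.exists_isReduct {w : FreeMonoid (Fin N)} (h : HasDescent w)
    (D : GPresentation K N) : ∃ f, D.IsReduct w f :=
  let ⟨u, v, i, j, hij, hw⟩ := h
  ⟨_, u, v, i, j, hij, hw, rfl⟩

theorem IsReduct.hasDescent {D : GPresentation K N} {w : FreeMonoid (Fin N)}
    {f : FreeAlgebra K (Fin N)} (h : D.IsReduct w f) : HasDescent w :=
  let ⟨u, v, i, j, hij, hw, _⟩ := h
  ⟨u, v, i, j, hij, hw⟩

/-- Words are compared by their exponents first, and then by their weights. -/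
def measure (m : MonomialOrder (Fin N)) (w : FreeMonoid (Fin N)) : m.syn ×ₗ ℕ :=
  toLex (m.toSyn (expo w), weight w)

/-- The words below `w`. -/
def below (m : MonomialOrder (Fin N)) (w : FreeMonoid (Fin N)) : Set (FreeMonoid (Fin N)) :=
  {w' | measure m w' < measure m w}

theorem mem_below_of_expo_lt {m : MonomialOrder (Fin N)} {w w' : FreeMonoid (Fin N)}
    (h : m.toSyn (expo w') < m.toSyn (expo w)) : w' ∈ below m w :=
  Prod.Lex.toLex_lt_toLex.2 (.inl h)

/-- The main term of a rule keeps the exponents, so the monomial ordering alone does not see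
termination; the weight breaks this tie. -/
theorem swap_mem_below (m : MonomialOrder (Fin N)) (u v : FreeMonoid (Fin N)) {i j : Fin N}
    (h : i < j) : u * of i * of j * v ∈ below m (u * of j * of i * v) :=
  Prod.Lex.toLex_lt_toLex.2 (.inr ⟨by simp [add_assoc, add_left_comm], weight_swap_lt u v h⟩)

theorem IsAdmissible.lt {D : GPresentation K N} {m : MonomialOrder (Fin N)} (hm : D.IsAdmissible m)
    {i j : Fin N} (hij : i < j) {a : Fin N →₀ ℕ} (ha : a ∈ (D.d i j).support) :
    m.toSyn a < m.toSyn (single i 1 + single j 1) :=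
  (m.le_degree ha).trans_lt (hm i j hij (by rintro h; simp [h] at ha))

theorem IsAdmissible.expo_lt {D : GPresentation K N} {m : MonomialOrder (Fin N)}
    (hm : D.IsAdmissible m) {i j : Fin N} (hij : i < j) {a : Fin N →₀ ℕ}
    (ha : a ∈ (D.d i j).support) (u v : FreeMonoid (Fin N)) :
    m.toSyn (expo (u * stdWord a * v)) < m.toSyn (expo (u * of j * of i * v)) := by
  have := hm.lt hij ha
  simp only [expo_mul, expo_of, expo_stdWord, map_add] at this ⊢
  rw [add_assoc (m.toSyn (expo u)) (m.toSyn (single j 1)), add_comm (m.toSyn (single j 1))]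
  exact add_lt_add_left (add_lt_add_right this _) _

theorem IsAdmissible.std_mem_below {D : GPresentation K N} {m : MonomialOrder (Fin N)}
    (hm : D.IsAdmissible m) {i j : Fin N} (hij : i < j) {a : Fin N →₀ ℕ}
    (ha : a ∈ (D.d i j).support) (u v : FreeMonoid (Fin N)) :
    u * stdWord a * v ∈ below m (u * of j * of i * v) :=
  mem_below_of_expo_lt (hm.expo_lt hij ha u v)

theorem mul_std_mul (u v : FreeAlgebra K (Fin N)) (P : MvPolynomial (Fin N) K) :
    u * std P * v = ∑ a ∈ P.support, P.coeff a • (u * stdMonomial K a * v) := by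
  simp [std, Finset.mul_sum, Finset.sum_mul]

theorem mul_rhs_mul (D : GPresentation K N) (u v : FreeMonoid (Fin N)) (i j : Fin N) :
    word K u * D.rhs i j * word K v = (D.c i j : K) • word K (u * of i * of j * v) +
      ∑ a ∈ (D.d i j).support, (D.d i j).coeff a • word K (u * stdWord a * v) := by
  rw [rhs, mul_add, add_mul, mul_std_mul]
  simp only [word_mul, word_stdWord, word_of, mul_smul_comm, smul_mul_assoc, mul_assoc]

/-- Termination of the rewriting: the swapped word drops in weight, and the tail drops in exponents
by admissibility. -/
theorem IsReduct.mem {D : GPresentation K N} {m : MonomialOrder (Fin N)}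
    (hm : D.IsAdmissible m) {w : FreeMonoid (Fin N)} {f : FreeAlgebra K (Fin N)}
    (h : D.IsReduct w f) : f ∈ wordSpan K (below m w) := by
  obtain ⟨u, v, i, j, hij, rfl, rfl⟩ := h
  rw [mul_rhs_mul]
  exact add_mem (Submodule.smul_mem _ _ (word_mem_wordSpan (swap_mem_below m u v hij)))
    (sum_mem fun a ha => Submodule.smul_mem _ _ (word_mem_wordSpan (hm.std_mem_below hij ha u v)))

open Classical in
/-- The normal form of a word, computed by repeatedly applying some rewriting rule. -/
def nfWord (D : GPresentation K N) (m : MonomialOrder (Fin N)) (w : FreeMonoid (Fin N)) :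
    MvPolynomial (Fin N) K :=
  if h : ∃ f, D.IsReduct w f then
    ((FreeAlgebra.basisFreeMonoid K (Fin N)).repr h.choose).sum fun w' c =>
      -- The test only serves the termination proof: for an admissible `m` it holds for every word
      -- of the reduct, so the value 0 is never taken.
      if _ : measure m w' < measure m w then c • nfWord D m w' else 0
  else MvPolynomial.monomial (expo w) 1
termination_by measure m w
decreasing_by assumption

/-- The normal form, as a linear map on the free algebra. -/
def nf (D : GPresentation K N) (m : MonomialOrder (Fin N)) :
    FreeAlgebra K (Fin N) →ₗ[K] MvPolynomial (Fin N) K :=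
  (FreeAlgebra.basisFreeMonoid K (Fin N)).constr K (D.nfWord m)

theorem nf_word (D : GPresentation K N) (m : MonomialOrder (Fin N)) (w : FreeMonoid (Fin N)) :
    D.nf m (word K w) = D.nfWord m w := by
  rw [nf, ← basisFreeMonoid_apply, Module.Basis.constr_basis]

theorem nf_word_of_not_hasDescent (D : GPresentation K N) (m : MonomialOrder (Fin N))
    {w : FreeMonoid (Fin N)} (h : ¬ HasDescent w) :
    D.nf m (word K w) = MvPolynomial.monomial (expo w) 1 := by
  rw [nf_word, nfWord, dif_neg]
  rintro ⟨f, hf⟩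
  exact h hf.hasDescent

/-- Only the one reduct chosen in the definition of `nfWord` is covered here; independence of that
choice is confluence. -/
theorem exists_isReduct_nf_word_eq {D : GPresentation K N} {m : MonomialOrder (Fin N)}
    (hm : D.IsAdmissible m) {w : FreeMonoid (Fin N)} (h : HasDescent w) :
    ∃ f, D.IsReduct w f ∧ D.nf m (word K w) = D.nf m f := by
  have hr := h.exists_isReduct D
  refine ⟨hr.choose, hr.choose_spec, ?_⟩
  rw [nf_word, nfWord, dif_pos hr, nf, Module.Basis.constr_apply]
  refine Finsupp.sum_congr fun w' hw' => ?_
  rw [dif_pos]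
  exact mem_of_mem_wordSpan (hr.choose_spec.mem hm) (Finsupp.mem_support_iff.1 hw')

/-! ### Confluence -/

theorem wordSpan_mono {s t : Set (FreeMonoid (Fin N))} (h : s ⊆ t) : wordSpan K s ≤ wordSpan K t :=
  Submodule.span_mono (Set.image_mono h)

/-- The words with exponents smaller than `e`. -/
def expoBelow (m : MonomialOrder (Fin N)) (e : Fin N →₀ ℕ) : Set (FreeMonoid (Fin N)) :=
  {w | m.toSyn (expo w) < m.toSyn e}

theorem below_subset_expoBelow {m : MonomialOrder (Fin N)} {w : FreeMonoid (Fin N)}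
    {e : Fin N →₀ ℕ} (h : w ∈ expoBelow m e) : below m w ⊆ expoBelow m e := by
  intro w' hw'
  rcases Prod.Lex.toLex_lt_toLex.1 hw' with h' | h'
  · exact h'.trans h
  · exact h'.1.trans_lt h

theorem mul_relator_mul (D : GPresentation K N) (u v : FreeMonoid (Fin N)) (i j : Fin N) :
    word K u * D.relator i j * word K v =
      word K (u * of j * of i * v) - word K u * D.rhs i j * word K v := by
  simp only [relator_eq, mul_sub, sub_mul, word_mul, word_of, mul_assoc]

theorem relator_mem_wordSpan {D : GPresentation K N} {m : MonomialOrder (Fin N)}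
    (hm : D.IsAdmissible m) {u v : FreeMonoid (Fin N)} {i j : Fin N} (hij : i < j)
    {e : Fin N →₀ ℕ} (h : u * of j * of i * v ∈ expoBelow m e) :
    word K u * D.relator i j * word K v ∈ wordSpan K (expoBelow m e) := by
  rw [mul_relator_mul]
  refine sub_mem (word_mem_wordSpan h) (wordSpan_mono (below_subset_expoBelow h) ?_)
  exact IsReduct.mem hm ⟨u, v, i, j, hij, rfl, rfl⟩

theorem mul_std_mul_mem_wordSpan {u v : FreeMonoid (Fin N)} {P : MvPolynomial (Fin N) K}
    {s : Set (FreeMonoid (Fin N))} (h : ∀ a ∈ P.support, u * stdWord a * v ∈ s) :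
    word K u * std P * word K v ∈ wordSpan K s := by
  rw [mul_std_mul]
  refine sum_mem fun a ha => Submodule.smul_mem _ _ ?_
  simpa using word_mem_wordSpan (K := K) (h a ha)

theorem std_mul_mem_wordSpan {v : FreeMonoid (Fin N)} {P : MvPolynomial (Fin N) K}
    {s : Set (FreeMonoid (Fin N))} (h : ∀ a ∈ P.support, stdWord a * v ∈ s) :
    std P * word K v ∈ wordSpan K s := by
  simpa using mul_std_mul_mem_wordSpan (u := 1) (v := v) (P := P) (by simpa using h)

theorem mul_std_mem_wordSpan {u : FreeMonoid (Fin N)} {P : MvPolynomial (Fin N) K}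
    {s : Set (FreeMonoid (Fin N))} (h : ∀ a ∈ P.support, u * stdWord a ∈ s) :
    word K u * std P ∈ wordSpan K s := by
  simpa using mul_std_mul_mem_wordSpan (u := u) (v := 1) (P := P) (by simpa using h)

/-- Each term is a tail `d` times the third variable, hence strictly below `x_i x_j x_k` in
exponents. Its reduction to zero therefore stays within the reach of the induction hypothesis. -/
theorem ndc_mem_wordSpan {D : GPresentation K N} {m : MonomialOrder (Fin N)}
    (hm : D.IsAdmissible m) {i j k : Fin N} (hij : i < j) (hjk : j < k) :
    D.ndc i j k ∈ wordSpan K (expoBelow m (single i 1 + single j 1 + single k 1)) := by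
  have key : ∀ {p q r : Fin N}, p < q →
      single p 1 + single q 1 + single r 1 = (single i 1 + single j 1 + single k 1 : Fin N →₀ ℕ) →
      std (D.d p q) * fx K r ∈ wordSpan K (expoBelow m (single i 1 + single j 1 + single k 1)) ∧
      fx K r * std (D.d p q) ∈ wordSpan K (expoBelow m (single i 1 + single j 1 + single k 1)) := by
    intro p q r hpq h
    rw [← h, ← word_of r]
    refine ⟨std_mul_mem_wordSpan fun a ha => ?_, mul_std_mem_wordSpan fun a ha => ?_⟩
    · simpa [expoBelow] using hm.lt hpq ha
    · rw [add_comm _ (single r 1)]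
      simpa [expoBelow] using hm.lt hpq ha
  have h1 := key (r := k) hij rfl
  have h2 := key (r := j) (hij.trans hjk) (by abel)
  have h3 := key (r := i) hjk (by abel)
  have sm : ∀ {c : K} {f : FreeAlgebra K (Fin N)} {S : Submodule K (FreeAlgebra K (Fin N))},
    f ∈ S → c • f ∈ S := fun h => Submodule.smul_mem _ _ h
  exact sub_mem (add_mem (sub_mem (add_mem (sub_mem (sm h1.1) h1.2) (sm h2.2)) (sm h2.1)) h3.1)
    (sm h3.2)

/-- The two ways of rewriting `x_k x_j x_i` are both continued down to `x_i x_j x_k`. The relators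
on the right rewrite only words smaller than `x_k x_j x_i`; what remains is the non-degeneracy
expression. -/
theorem rhs_mul_sub_mul_rhs (D : GPresentation K N) (i j k : Fin N) :
    D.rhs j k * fx K i - fx K k * D.rhs i j =
      (D.c j k : K) • (fx K j * D.relator i k) +
      ((D.c j k : K) * D.c i k) • (D.relator i j * fx K k) -
      (D.c i j : K) • (D.relator i k * fx K j) -
      ((D.c i j : K) * D.c i k) • (fx K i * D.relator j k) + D.ndc i j k := by
  simp only [relator, rhs, ndc, mul_add, add_mul, mul_sub, sub_mul, smul_mul_assoc, mul_smul_comm,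
    mul_assoc]
  module

/-- A reduction step subtracts a multiple of a relator at a word occurring in `f`, hence a word
below `e`, and the span of such words is stable under these steps. A general `φ` is allowed in order
to apply this to `f ↦ nf (u f v)`. -/
theorem map_eq_zero_of_reducesToZero {D : GPresentation K N} {m : MonomialOrder (Fin N)}
    (hm : D.IsAdmissible m) {e : Fin N →₀ ℕ} {M : Type*} [AddCommGroup M] [Module K M]
    (φ : FreeAlgebra K (Fin N) →ₗ[K] M)
    (hφ : ∀ (u v : FreeMonoid (Fin N)) (i j : Fin N), i < j →
      u * of j * of i * v ∈ expoBelow m e → φ (word K u * D.relator i j * word K v) = 0)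
    {f : FreeAlgebra K (Fin N)} (hf : f ∈ wordSpan K (expoBelow m e)) (h : D.ReducesToZero f) :
    φ f = 0 := by
  induction h using Relation.ReflTransGen.head_induction_on with
  | refl => simp
  | head hstep _ ih =>
    obtain ⟨u, v, i, j, hij, hc, rfl⟩ := hstep
    have hw := mem_of_mem_wordSpan hf hc
    have := ih (sub_mem hf (Submodule.smul_mem _ _ (relator_mem_wordSpan hm hij hw)))
    simpa [hφ u v i j hij hw] using this

theorem nf_mul_relator_mul_of_forall {D : GPresentation K N} {m : MonomialOrder (Fin N)}
    {w : FreeMonoid (Fin N)}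
    (IH : ∀ w' ∈ below m w, ∀ f, D.IsReduct w' f → D.nf m (word K w') = D.nf m f)
    {u v : FreeMonoid (Fin N)} {i j : Fin N} (hij : i < j)
    (h : u * of j * of i * v ∈ below m w) :
    D.nf m (word K u * D.relator i j * word K v) = 0 := by
  rw [mul_relator_mul, map_sub, IH _ h _ ⟨u, v, i, j, hij, rfl, rfl⟩, sub_self]

/-- Applying both rules gives a common result. The difference of the two reducts is thus a
combination of relators, each at words where the other rule has already been applied, so the
induction hypothesis covers them. -/
theorem nf_disjoint {D : GPresentation K N} {m : MonomialOrder (Fin N)}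
    (hm : D.IsAdmissible m) {u s v : FreeMonoid (Fin N)} {i j i' j' : Fin N}
    (hij : i < j) (hij' : i' < j')
    (IH : ∀ w' ∈ below m (u * of j * of i * (s * of j' * of i' * v)), ∀ f, D.IsReduct w' f →
      D.nf m (word K w') = D.nf m f) :
    D.nf m (word K u * D.rhs i j * word K (s * of j' * of i' * v)) =
      D.nf m (word K (u * of j * of i * s) * D.rhs i' j' * word K v) := by
  have h1 : word K u * D.rhs i j * word K (s * of j' * of i' * v) -
      word K (u * of j * of i * s) * D.rhs i' j' * word K v =
      (word K u * D.rhs i j * word K s) * D.relator i' j' * word K v -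
      word K u * D.relator i j * (word K s * D.rhs i' j' * word K v) := by
    simp only [relator_eq, word_mul, word_of, mul_sub, sub_mul, mul_assoc]
    abel
  rw [← sub_eq_zero, ← map_sub, h1, map_sub, mul_rhs_mul, mul_rhs_mul]
  have e1 : ∀ {x : FreeMonoid (Fin N)},
      x * (s * of j' * of i' * v) ∈ below m (u * of j * of i * (s * of j' * of i' * v)) →
      D.nf m (word K (x * s) * D.relator i' j' * word K v) = 0 := fun hx =>
    nf_mul_relator_mul_of_forall IH hij' (by simpa only [mul_assoc] using hx)
  have e2 : ∀ {x : FreeMonoid (Fin N)},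
      u * of j * of i * x ∈ below m (u * of j * of i * (s * of j' * of i' * v)) →
      D.nf m (word K u * D.relator i j * word K x) = 0 := fun hx =>
    nf_mul_relator_mul_of_forall IH hij hx
  have e3 : u * of j * of i * (s * of i' * of j' * v) ∈
      below m (u * of j * of i * (s * of j' * of i' * v)) := by
    simpa only [mul_assoc] using swap_mem_below m (u * of j * of i * s) v hij'
  have e4 : ∀ a ∈ (D.d i' j').support, u * of j * of i * (s * stdWord a * v) ∈
      below m (u * of j * of i * (s * of j' * of i' * v)) := fun a ha => by
    simpa only [mul_assoc] using hm.std_mem_below hij' ha (u * of j * of i * s) v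
  have e5 : u * of i * of j * (s * of j' * of i' * v) ∈
      below m (u * of j * of i * (s * of j' * of i' * v)) := swap_mem_below m u _ hij
  have e6 : ∀ a ∈ (D.d i j).support, u * stdWord a * (s * of j' * of i' * v) ∈
      below m (u * of j * of i * (s * of j' * of i' * v)) := fun a ha =>
    hm.std_mem_below hij ha u _
  simp only [add_mul, mul_add, Finset.sum_mul, Finset.mul_sum, smul_mul_assoc, mul_smul_comm,
    map_add, map_sum, map_smul]
  rw [e1 e5, e2 e3,
    Finset.sum_eq_zero fun a ha => by rw [e1 (e6 a ha), smul_zero],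
    Finset.sum_eq_zero fun a ha => by rw [e2 (e4 a ha), smul_zero]]
  simp

theorem nf_overlap {D : GPresentation K N} (hD : D.IsGAlgebra) {m : MonomialOrder (Fin N)}
    (hm : D.IsAdmissible m) {u v : FreeMonoid (Fin N)} {i j k : Fin N}
    (hij : i < j) (hjk : j < k)
    (IH : ∀ w' ∈ below m (u * of k * of j * of i * v), ∀ f, D.IsReduct w' f →
      D.nf m (word K w') = D.nf m f) :
    D.nf m (word K u * D.rhs j k * word K (of i * v)) =
      D.nf m (word K (u * of k) * D.rhs i j * word K v) := by
  have h1 : word K u * D.rhs j k * word K (of i * v) - word K (u * of k) * D.rhs i j * word K v =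
      word K u * (D.rhs j k * fx K i - fx K k * D.rhs i j) * word K v := by
    simp only [word_mul, word_of, mul_sub, sub_mul, mul_assoc]
  have hik := hij.trans hjk
  have r1 : word K u * (fx K j * D.relator i k) * word K v =
      word K (u * of j) * D.relator i k * word K v := by simp [mul_assoc]
  have r2 : word K u * (D.relator i j * fx K k) * word K v =
      word K u * D.relator i j * word K (of k * v) := by simp [mul_assoc]
  have r3 : word K u * (D.relator i k * fx K j) * word K v =
      word K u * D.relator i k * word K (of j * v) := by simp [mul_assoc]
  have r4 : word K u * (fx K i * D.relator j k) * word K v =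
      word K (u * of i) * D.relator j k * word K v := by simp [mul_assoc]
  have b1 : u * of j * of k * of i * v ∈ below m (u * of k * of j * of i * v) := by
    simpa only [mul_assoc] using swap_mem_below m u (of i * v) hjk
  have b3 : u * of k * of i * of j * v ∈ below m (u * of k * of j * of i * v) :=
    swap_mem_below m (u * of k) v hij
  have b2 : u * of j * of i * of k * v ∈ below m (u * of k * of j * of i * v) :=
    lt_trans (b := measure m (u * of j * of k * of i * v)) (swap_mem_below m (u * of j) v hik) b1
  have b4 : u * of i * of k * of j * v ∈ below m (u * of k * of j * of i * v) := by
    have h : u * of i * of k * of j * v ∈ below m (u * of k * of i * of j * v) := by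
      simpa only [mul_assoc] using swap_mem_below m u (of j * v) hik
    exact lt_trans (b := measure m (u * of k * of i * of j * v)) h b3
  have b5 : D.nf m (word K u * D.ndc i j k * word K v) = 0 := by
    refine map_eq_zero_of_reducesToZero hm
      (D.nf m ∘ₗ LinearMap.mulRight K (word K v) ∘ₗ LinearMap.mulLeft K (word K u)) ?_
      (ndc_mem_wordSpan hm hij hjk) (hD.nondegenerate i j k hij hjk)
    -- Translation invariance of the ordering carries the bound on exponents into the context `u _
    -- v`.
    intro a b p q hpq hab
    have : word K u * (word K a * D.relator p q * word K b) * word K v =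
      word K (u * a) * D.relator p q * word K (b * v) := by simp [mul_assoc]
    simp only [LinearMap.comp_apply, LinearMap.mulLeft_apply, LinearMap.mulRight_apply, this]
    apply nf_mul_relator_mul_of_forall IH hpq
    apply mem_below_of_expo_lt
    have hab' : m.toSyn (expo (a * of q * of p * b)) <
      m.toSyn (single i 1 + single j 1 + single k 1) := hab
    have := add_lt_add_right hab' (m.toSyn (expo u + expo v))
    simp only [expo_mul, expo_of, map_add] at this ⊢
    simpa only [add_comm, add_left_comm] using this
  rw [← sub_eq_zero, ← map_sub, h1, rhs_mul_sub_mul_rhs]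
  simp only [mul_add, add_mul, mul_sub, sub_mul, mul_smul_comm, smul_mul_assoc, map_add, map_sub,
    map_smul, r1, r2, r3, r4]
  rw [b5, nf_mul_relator_mul_of_forall IH hik b1,
    nf_mul_relator_mul_of_forall IH hij (by simpa only [mul_assoc] using b2),
    nf_mul_relator_mul_of_forall IH hik (by simpa only [mul_assoc] using b3),
    nf_mul_relator_mul_of_forall IH hjk b4]
  simp

/-- Two descents of a word coincide, overlap, or are disjoint. -/
theorem descent_cases {u v u' v' : FreeMonoid (Fin N)} {i j i' j' : Fin N}
    (h : u * of j * of i * v = u' * of j' * of i' * v') (hlen : u.length ≤ u'.length) :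
    (u = u' ∧ j = j' ∧ i = i' ∧ v = v') ∨
    (u' = u * of j ∧ j' = i ∧ v = of i' * v') ∨
    ∃ s, u' = u * of j * of i * s ∧ v = s * of j' * of i' * v' := by
  replace h : u.toList ++ j :: i :: v.toList = u'.toList ++ j' :: i' :: v'.toList := by
    simpa using congrArg toList h
  rw [List.append_eq_append_iff] at h
  have hof : ∀ {x y : FreeMonoid (Fin N)}, x.toList = y.toList → x = y :=
    fun h => toList.injective h
  have hnil : ∀ {as : List (Fin N)}, as = [] → u'.toList = u.toList ++ as →
      j :: i :: v.toList = as ++ j' :: i' :: v'.toList →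
      (u = u' ∧ j = j' ∧ i = i' ∧ v = v') := by
    rintro _ rfl h1 h2
    simp only [List.append_nil, List.nil_append, List.cons.injEq] at h1 h2
    exact ⟨(hof h1).symm, h2.1, h2.2.1, hof h2.2.2⟩
  rcases h with ⟨as, h1, h2⟩ | ⟨bs, h1, h2⟩
  · match as, h1, h2 with
    | [], h1, h2 => exact .inl (hnil rfl h1 h2)
    | [x], h1, h2 =>
      simp only [List.cons_append, List.nil_append, List.cons.injEq] at h2
      obtain ⟨rfl, rfl, h3⟩ := h2
      exact .inr (.inl ⟨hof (by simpa using h1), rfl, hof (by simpa using h3)⟩)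
    | x :: y :: s, h1, h2 =>
      simp only [List.cons_append, List.cons.injEq] at h2
      obtain ⟨rfl, rfl, h3⟩ := h2
      exact .inr (.inr ⟨ofList s, hof (by simpa using h1), hof (by simpa using h3)⟩)
  · have hb : bs = [] := by
      have h3 : u.toList.length = u'.toList.length + bs.length := by rw [h1, List.length_append]
      have h4 : u.toList.length ≤ u'.toList.length := hlen
      exact List.eq_nil_of_length_eq_zero (by omega)
    subst hb
    exact .inl (hnil rfl (by simpa using h1.symm) (by simpa using h2.symm))

/-- Local confluence, with the two descents ordered from left to right. -/
theorem nf_eq_of_isReduct_aux {D : GPresentation K N} (hD : D.IsGAlgebra)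
    {m : MonomialOrder (Fin N)} (hm : D.IsAdmissible m) {w : FreeMonoid (Fin N)}
    (IH : ∀ w' ∈ below m w, ∀ f, D.IsReduct w' f → D.nf m (word K w') = D.nf m f)
    {u v u' v' : FreeMonoid (Fin N)} {i j i' j' : Fin N} (hij : i < j) (hij' : i' < j')
    (h : w = u * of j * of i * v) (h' : w = u' * of j' * of i' * v')
    (hlen : u.length ≤ u'.length) :
    D.nf m (word K u * D.rhs i j * word K v) = D.nf m (word K u' * D.rhs i' j' * word K v') := by
  subst h
  rcases descent_cases h' hlen with ⟨rfl, rfl, rfl, rfl⟩ | ⟨rfl, rfl, rfl⟩ | ⟨s, rfl, rfl⟩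
  · rfl
  · exact nf_overlap hD hm hij' hij (by simpa only [mul_assoc] using IH)
  · exact nf_disjoint hm hij hij' IH

/-- The rewriting system is confluent. -/
theorem nf_word_eq_of_isReduct {D : GPresentation K N} (hD : D.IsGAlgebra)
    {m : MonomialOrder (Fin N)} (hm : D.IsAdmissible m) (w : FreeMonoid (Fin N)) :
    ∀ f, D.IsReduct w f → D.nf m (word K w) = D.nf m f := by
  induction hμ : measure m w using WellFoundedLT.induction generalizing w with
  | ind μ ih =>
  subst hμ
  intro f hf
  obtain ⟨g, hg, hwg⟩ := exists_isReduct_nf_word_eq hm hf.hasDescent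
  have IH : ∀ w' ∈ below m w, ∀ f, D.IsReduct w' f → D.nf m (word K w') = D.nf m f :=
    fun w' hw' => ih _ hw' w' rfl
  rw [hwg]
  obtain ⟨u, v, i, j, hij, h, rfl⟩ := hf
  obtain ⟨u', v', i', j', hij', h', rfl⟩ := hg
  rcases le_total u.length u'.length with hl | hl
  · exact (nf_eq_of_isReduct_aux hD hm IH hij hij' h h' hl).symm
  · exact nf_eq_of_isReduct_aux hD hm IH hij' hij h' h hl

theorem nf_mul_relator_mul {D : GPresentation K N} (hD : D.IsGAlgebra)
    {m : MonomialOrder (Fin N)} (hm : D.IsAdmissible m) {i j : Fin N} (hij : i < j)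
    (f g : FreeAlgebra K (Fin N)) : D.nf m (f * D.relator i j * g) = 0 := by
  induction eq_sum_word f using Submodule.span_induction with
  | zero => simp
  | add x y _ _ hx hy => rw [add_mul, add_mul, map_add, hx, hy, add_zero]
  | smul c x _ hx => rw [smul_mul_assoc, smul_mul_assoc, map_smul, hx, smul_zero]
  | mem x hx =>
    obtain ⟨u, rfl⟩ := hx
    induction eq_sum_word g using Submodule.span_induction with
    | zero => simp
    | add x y _ _ hx hy => rw [mul_add, map_add, hx, hy, add_zero]
    | smul c x _ hx => rw [mul_smul_comm, map_smul, hx, smul_zero]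
    | mem x hx =>
      obtain ⟨v, rfl⟩ := hx
      -- Confluence is now known for all words, so any word above `u x_j x_i v` will do; one extra
      -- letter provides it.
      exact nf_mul_relator_mul_of_forall (w := u * of j * of i * v * of j)
        (fun w' _ => nf_word_eq_of_isReduct hD hm w') hij (mem_below_of_expo_lt (by
          rw [expo_mul (_ * v), map_add, lt_add_iff_pos_right, m.toSyn_lt_iff_ne_zero, ne_eq,
            m.toSyn_eq_zero_iff, expo_of]
          simp))

theorem nf_eq_of_proj_eq {D : GPresentation K N} (hD : D.IsGAlgebra)
    {m : MonomialOrder (Fin N)} (hm : D.IsAdmissible m) {f g : FreeAlgebra K (Fin N)}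
    (h : D.proj f = D.proj g) : D.nf m f = D.nf m g := by
  have h1 : Relation.EqvGen (RingQuot.Rel D.Rel) f g := by
    rw [← Quot.eq]
    simpa [proj, RingQuot.mkAlgHom_def, RingQuot.mkRingHom_def] using h
  -- Two-sided multiples make the claim stable under the multiplication steps of the generated
  -- congruence.
  suffices ∀ a b, D.nf m (a * f * b) = D.nf m (a * g * b) by simpa using this 1 1
  clear h
  induction h1 with
  | refl => intros; rfl
  | symm _ _ _ ih => exact fun a b => (ih a b).symm
  | trans _ _ _ _ _ ih₁ ih₂ => exact fun a b => (ih₁ a b).trans (ih₂ a b)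
  | rel x y hxy =>
    induction hxy with
    | of h =>
      obtain ⟨i, j, hij⟩ := h
      intro a b
      rw [← sub_eq_zero, ← map_sub, ← sub_mul, ← mul_sub]
      have := nf_mul_relator_mul hD hm hij a b
      rwa [relator_eq] at this
    | add_left _ ih => intro a b; simp only [mul_add, add_mul, map_add, ih]
    | mul_left _ ih => intro a b; simpa only [mul_assoc] using ih a (_ * b)
    | mul_right _ ih => intro a b; simpa only [mul_assoc] using ih (a * _) b

/-! ### The standard monomials are a basis -/

/-- `std` as a linear map. -/
def stdLinearMap (K : Type*) [Field K] (N : ℕ) :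
    MvPolynomial (Fin N) K →ₗ[K] FreeAlgebra K (Fin N) :=
  (MvPolynomial.basisMonomials (Fin N) K).constr K (stdMonomial K)

theorem stdLinearMap_monomial (a : Fin N →₀ ℕ) :
    stdLinearMap K N (MvPolynomial.monomial a 1) = stdMonomial K a := by
  have := (MvPolynomial.basisMonomials (Fin N) K).constr_basis K (stdMonomial K) a
  rwa [MvPolynomial.coe_basisMonomials] at this

theorem eq_sum_smul_monomial (P : MvPolynomial (Fin N) K) :
    P = ∑ a ∈ P.support, P.coeff a • MvPolynomial.monomial a 1 := by
  conv_lhs => rw [P.as_sum]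
  simp [MvPolynomial.smul_monomial]

theorem stdLinearMap_apply (P : MvPolynomial (Fin N) K) : stdLinearMap K N P = std P := by
  conv_lhs => rw [eq_sum_smul_monomial P]
  simp [stdLinearMap_monomial, std]

theorem nf_stdMonomial (D : GPresentation K N) (m : MonomialOrder (Fin N)) (a : Fin N →₀ ℕ) :
    D.nf m (stdMonomial K a) = MvPolynomial.monomial a 1 := by
  rw [← word_stdWord, nf_word_of_not_hasDescent _ _ (not_hasDescent_stdWord a), expo_stdWord]

theorem nf_std (D : GPresentation K N) (m : MonomialOrder (Fin N)) (P : MvPolynomial (Fin N) K) :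
    D.nf m (std P) = P := by
  conv_rhs => rw [eq_sum_smul_monomial P]
  simp [std, nf_stdMonomial]

theorem proj_relator (D : GPresentation K N) {i j : Fin N} (h : i < j) :
    D.proj (D.relator i j) = 0 := by
  rw [relator_eq, map_sub, sub_eq_zero]
  exact RingQuot.mkAlgHom_rel K (Rel.mk i j h)

theorem IsReduct.proj_eq {D : GPresentation K N} {w : FreeMonoid (Fin N)}
    {f : FreeAlgebra K (Fin N)} (h : D.IsReduct w f) : D.proj (word K w) = D.proj f := by
  obtain ⟨u, v, i, j, hij, rfl, rfl⟩ := h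
  rw [← sub_eq_zero, ← map_sub, ← mul_relator_mul, map_mul, map_mul, proj_relator D hij, mul_zero,
    zero_mul]

theorem proj_std_nf {D : GPresentation K N} {m : MonomialOrder (Fin N)}
    (hm : D.IsAdmissible m) (f : FreeAlgebra K (Fin N)) :
    D.proj (std (D.nf m f)) = D.proj f := by
  let φ : FreeAlgebra K (Fin N) →ₗ[K] D.Alg :=
    D.proj.toLinearMap ∘ₗ stdLinearMap K N ∘ₗ D.nf m
  have hφ : ∀ f, φ f = D.proj (std (D.nf m f)) := fun f => by simp [φ, stdLinearMap_apply]
  -- The set `s` is first the set of words below a given one, inside the induction, and finally the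
  -- set of all words.
  have key : ∀ {s : Set (FreeMonoid (Fin N))}, (∀ w ∈ s, φ (word K w) = D.proj (word K w)) →
      ∀ f ∈ wordSpan K s, φ f = D.proj f := by
    intro s hs f hf
    induction hf using Submodule.span_induction with
    | zero => simp
    | add x y _ _ hx hy => rw [map_add, map_add, hx, hy]
    | smul c x _ hx => rw [map_smul, map_smul, hx]
    | mem x hx =>
      obtain ⟨w, hw, rfl⟩ := hx
      rw [basisFreeMonoid_apply, hs w hw]
  have hw : ∀ w, φ (word K w) = D.proj (word K w) := by
    intro w
    induction hμ : measure m w using WellFoundedLT.induction generalizing w with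
    | ind μ ih =>
    subst hμ
    by_cases h : HasDescent w
    · obtain ⟨f, hf, hwf⟩ := exists_isReduct_nf_word_eq hm h
      rw [hf.proj_eq, hφ, hwf, ← hφ]
      exact key (fun w' hw' => ih _ hw' w' rfl) f (hf.mem hm)
    · rw [hφ, nf_word_of_not_hasDescent D m h]
      conv_rhs => rw [eq_stdWord_of_not_hasDescent h, word_stdWord]
      rw [← stdLinearMap_apply, stdLinearMap_monomial]
  rw [← hφ]
  refine key (s := Set.univ) (fun w _ => hw w) f ?_
  simp [wordSpan]

/-- The polynomials all of whose monomials are smaller than `e`. -/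
abbrev lowerTerms (K : Type*) [Field K] {N : ℕ} (m : MonomialOrder (Fin N)) (e : Fin N →₀ ℕ) :
    Submodule K (MvPolynomial (Fin N) K) :=
  MvPolynomial.restrictSupport K {a | m.toSyn a < m.toSyn e}

/-- Every swap contributes a unit factor `c_ij` to the top monomial, while the tails have smaller
exponents and cannot cancel it. -/
theorem nf_word_leading {D : GPresentation K N} {m : MonomialOrder (Fin N)}
    (hm : D.IsAdmissible m) (w : FreeMonoid (Fin N)) :
    ∃ κ : K, κ ≠ 0 ∧
      D.nf m (word K w) - κ • MvPolynomial.monomial (expo w) 1 ∈ lowerTerms K m (expo w) := by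
  induction hμ : measure m w using WellFoundedLT.induction generalizing w with
  | ind μ ih =>
  subst hμ
  by_cases h : HasDescent w
  · obtain ⟨f, hf, hwf⟩ := exists_isReduct_nf_word_eq hm h
    obtain ⟨u, v, i, j, hij, rfl, rfl⟩ := hf
    obtain ⟨κ, hκ, hlow⟩ := ih _ (swap_mem_below m u v hij) _ rfl
    have he : expo (u * of i * of j * v) = expo (u * of j * of i * v) := by
      simp [add_assoc, add_left_comm]
    rw [he] at hlow
    refine ⟨D.c i j * κ, mul_ne_zero (D.c i j).ne_zero hκ, ?_⟩
    rw [hwf, mul_rhs_mul, map_add, map_smul, mul_smul, add_sub_right_comm, ← smul_sub, map_sum]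
    refine add_mem (Submodule.smul_mem _ _ hlow) (sum_mem fun a ha => ?_)
    rw [map_smul]
    refine Submodule.smul_mem _ _ ?_
    have hb := hm.std_mem_below hij ha u v
    have hlt := hm.expo_lt hij ha u v
    obtain ⟨κ', -, hlow'⟩ := ih _ hb _ rfl
    rw [← sub_add_cancel (D.nf m (word K (u * stdWord a * v)))
      (κ' • MvPolynomial.monomial (expo (u * stdWord a * v)) 1)]
    refine add_mem (MvPolynomial.restrictSupport_mono K (fun b hb => lt_trans hb hlt) hlow')
      (Submodule.smul_mem _ _ ?_)
    rw [MvPolynomial.mem_restrictSupport_iff]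
    refine (Finset.coe_subset.2 MvPolynomial.support_monomial_subset).trans ?_
    simpa using hlt
  · refine ⟨1, one_ne_zero, ?_⟩
    rw [nf_word_of_not_hasDescent D m h, one_smul, sub_self]
    exact zero_mem _

/-! ### Normal forms in the quotient algebra -/

theorem normalForm_proj_std {D : GPresentation K N} (hD : D.IsGAlgebra)
    (P : MvPolynomial (Fin N) K) : D.normalForm (D.proj (std P)) = P := by
  obtain ⟨m, hm⟩ := hD.exists_admissible
  refine Function.leftInverse_invFun (fun P Q h => ?_) P
  rw [← nf_std D m P, ← nf_std D m Q]
  exact nf_eq_of_proj_eq hD hm h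

theorem normalForm_proj {D : GPresentation K N} (hD : D.IsGAlgebra) {m : MonomialOrder (Fin N)}
    (hm : D.IsAdmissible m) (f : FreeAlgebra K (Fin N)) : D.normalForm (D.proj f) = D.nf m f := by
  rw [← proj_std_nf hm f, normalForm_proj_std hD]

theorem proj_surjective (D : GPresentation K N) : Function.Surjective D.proj :=
  RingQuot.mkAlgHom_surjective K _

theorem proj_std_normalForm {D : GPresentation K N} (hD : D.IsGAlgebra) (f : D.Alg) :
    D.proj (std (D.normalForm f)) = f := by
  obtain ⟨m, hm⟩ := hD.exists_admissible
  obtain ⟨f, rfl⟩ := D.proj_surjective f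
  rw [normalForm_proj hD hm, proj_std_nf hm]

theorem bijective_proj_std {D : GPresentation K N} (hD : D.IsGAlgebra) :
    Function.Bijective (D.proj.toLinearMap ∘ₗ stdLinearMap K N) :=
  ⟨Function.LeftInverse.injective (g := D.normalForm) fun P => by
    simp [stdLinearMap_apply, normalForm_proj_std hD],
  fun f => ⟨D.normalForm f, by simp [stdLinearMap_apply, proj_std_normalForm hD]⟩⟩

/-- The algebra is isomorphic, as a vector space, to the space of polynomials. -/
def normalFormEquiv {D : GPresentation K N} (hD : D.IsGAlgebra) :
    D.Alg ≃ₗ[K] MvPolynomial (Fin N) K :=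
  (LinearEquiv.ofBijective _ (bijective_proj_std hD)).symm

@[simp] theorem normalFormEquiv_apply {D : GPresentation K N} (hD : D.IsGAlgebra) (f : D.Alg) :
    normalFormEquiv hD f = D.normalForm f := by
  rw [normalFormEquiv, LinearEquiv.symm_apply_eq]
  simp [stdLinearMap_apply, proj_std_normalForm hD]

theorem normalForm_eq_zero_iff {D : GPresentation K N} (hD : D.IsGAlgebra) {f : D.Alg} :
    D.normalForm f = 0 ↔ f = 0 := by
  rw [← normalFormEquiv_apply hD, LinearEquiv.map_eq_zero_iff]

/-- The standard monomial with exponents `a` in the algebra. -/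
def mon (D : GPresentation K N) (a : Fin N →₀ ℕ) : D.Alg := D.proj (stdMonomial K a)

theorem normalForm_mon {D : GPresentation K N} (hD : D.IsGAlgebra) (a : Fin N →₀ ℕ) :
    D.normalForm (D.mon a) = MvPolynomial.monomial a 1 := by
  rw [mon, ← stdLinearMap_monomial, stdLinearMap_apply, normalForm_proj_std hD]

theorem normalFormEquiv_symm_monomial {D : GPresentation K N} (hD : D.IsGAlgebra)
    (a : Fin N →₀ ℕ) : (normalFormEquiv hD).symm (MvPolynomial.monomial a 1) = D.mon a := by
  rw [LinearEquiv.symm_apply_eq, normalFormEquiv_apply, normalForm_mon hD]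

/-- The elements all of whose monomials have exponents in `s`. -/
def filt {D : GPresentation K N} (hD : D.IsGAlgebra) (s : Set (Fin N →₀ ℕ)) :
    Submodule K D.Alg :=
  (MvPolynomial.restrictSupport K s).comap (normalFormEquiv hD).toLinearMap

theorem mem_filt_iff {D : GPresentation K N} (hD : D.IsGAlgebra) {s : Set (Fin N →₀ ℕ)}
    {f : D.Alg} : f ∈ filt hD s ↔ ∀ a ∈ (D.normalForm f).support, a ∈ s := by
  rw [filt, Submodule.mem_comap, MvPolynomial.mem_restrictSupport_iff]
  simp [Set.subset_def]

theorem filt_mono {D : GPresentation K N} (hD : D.IsGAlgebra) {s t : Set (Fin N →₀ ℕ)}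
    (h : s ⊆ t) : filt hD s ≤ filt hD t :=
  Submodule.comap_mono (MvPolynomial.restrictSupport_mono K h)

theorem filt_eq_span {D : GPresentation K N} (hD : D.IsGAlgebra) (s : Set (Fin N →₀ ℕ)) :
    filt hD s = Submodule.span K (D.mon '' s) := by
  have h1 : filt hD s =
      (MvPolynomial.restrictSupport K s).map (normalFormEquiv hD).symm.toLinearMap :=
    Submodule.comap_equiv_eq_map_symm _ _
  rw [h1, MvPolynomial.restrictSupport_eq_span, Submodule.map_span, Set.image_image]
  congr 2
  ext1 a
  exact normalFormEquiv_symm_monomial hD a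

theorem mon_mem_filt {D : GPresentation K N} (hD : D.IsGAlgebra) {s : Set (Fin N →₀ ℕ)}
    {a : Fin N →₀ ℕ} (h : a ∈ s) : D.mon a ∈ filt hD s := by
  rw [filt_eq_span]
  exact Submodule.subset_span ⟨a, h, rfl⟩

/-! ### Leading terms of products -/

theorem mon_mul_mon {D : GPresentation K N} (hD : D.IsGAlgebra) {m : MonomialOrder (Fin N)}
    (hm : D.IsAdmissible m) (a b : Fin N →₀ ℕ) :
    ∃ κ : K, κ ≠ 0 ∧
      D.mon a * D.mon b - κ • D.mon (a + b) ∈ filt hD {c | m.toSyn c < m.toSyn (a + b)} := by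
  obtain ⟨κ, hκ, h⟩ := nf_word_leading hm (stdWord a * stdWord b)
  refine ⟨κ, hκ, ?_⟩
  rw [filt, Submodule.mem_comap, LinearEquiv.coe_coe, map_sub, map_smul, normalFormEquiv_apply,
    normalFormEquiv_apply, normalForm_mon hD, mon, mon, ← map_mul, normalForm_proj hD hm]
  rwa [word_mul, word_stdWord, word_stdWord, expo_mul, expo_stdWord, expo_stdWord] at h

/-- The sets are left general so that one lemma serves both the leading term estimates and the
filtration by ∂-degree. -/
theorem mul_mem_filt {D : GPresentation K N} (hD : D.IsGAlgebra) {m : MonomialOrder (Fin N)}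
    (hm : D.IsAdmissible m) {s t r : Set (Fin N →₀ ℕ)}
    (h : ∀ a ∈ s, ∀ b ∈ t, ∀ c, m.toSyn c ≤ m.toSyn (a + b) → c ∈ r) {f g : D.Alg}
    (hf : f ∈ filt hD s) (hg : g ∈ filt hD t) : f * g ∈ filt hD r := by
  suffices filt hD s * filt hD t ≤ filt hD r from this (Submodule.mul_mem_mul hf hg)
  rw [filt_eq_span hD s, filt_eq_span hD t, Submodule.span_mul_span, Submodule.span_le]
  rintro _ ⟨_, ⟨a, ha, rfl⟩, _, ⟨b, hb, rfl⟩, rfl⟩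
  obtain ⟨κ, -, hκ⟩ := mon_mul_mon hD hm a b
  have := add_mem (filt_mono hD (fun c hc => h a ha b hb c (le_of_lt hc)) hκ)
    (Submodule.smul_mem _ κ (mon_mem_filt hD (h a ha b hb _ le_rfl)))
  simpa using this

theorem sub_leading_mem_filt {D : GPresentation K N} (hD : D.IsGAlgebra)
    (m : MonomialOrder (Fin N)) (f : D.Alg) :
    f - m.leadingCoeff (D.normalForm f) • D.mon (m.degree (D.normalForm f)) ∈
      filt hD {c | m.toSyn c < m.toSyn (m.degree (D.normalForm f))} := by
  rw [filt, Submodule.mem_comap, LinearEquiv.coe_coe, map_sub, map_smul, normalFormEquiv_apply,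
    normalFormEquiv_apply, normalForm_mon hD, MvPolynomial.mem_restrictSupport_iff]
  intro c hc
  rw [Finset.mem_coe, MvPolynomial.mem_support_iff, MvPolynomial.coeff_sub,
    MvPolynomial.coeff_smul, MvPolynomial.coeff_monomial] at hc
  by_cases h : m.degree (D.normalForm f) = c
  · subst h
    simp [MonomialOrder.leadingCoeff] at hc
  · rw [if_neg h, smul_zero, sub_zero] at hc
    exact lt_of_le_of_ne (m.le_degree (MvPolynomial.mem_support_iff.2 hc))
      fun h' => h (m.toSyn.injective h').symm

theorem degree_normalForm_of_sub_mem_filt {D : GPresentation K N} (hD : D.IsGAlgebra)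
    {m : MonomialOrder (Fin N)} {f : D.Alg} {κ : K} (hκ : κ ≠ 0) {e : Fin N →₀ ℕ}
    (h : f - κ • D.mon e ∈ filt hD {c | m.toSyn c < m.toSyn e}) :
    f ≠ 0 ∧ m.degree (D.normalForm f) = e := by
  rw [filt, Submodule.mem_comap, LinearEquiv.coe_coe, map_sub, map_smul, normalFormEquiv_apply,
    normalFormEquiv_apply, normalForm_mon hD, MvPolynomial.mem_restrictSupport_iff] at h
  have hc : ∀ c, ¬ m.toSyn c < m.toSyn e → (D.normalForm f).coeff c = if e = c then κ else 0 := by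
    intro c hc
    have := MvPolynomial.notMem_support_iff.1 fun h' => hc (h h')
    rw [MvPolynomial.coeff_sub, MvPolynomial.coeff_smul, MvPolynomial.coeff_monomial,
      sub_eq_zero] at this
    simpa using this
  have he : e ∈ (D.normalForm f).support := by
    rw [MvPolynomial.mem_support_iff, hc e (lt_irrefl _), if_pos rfl]
    exact hκ
  refine ⟨?_, m.toSyn.injective (le_antisymm ?_ (m.le_degree he))⟩
  · rintro rfl
    rw [(normalForm_eq_zero_iff hD).2 rfl] at he
    simp at he
  · rw [m.degree_le_iff]
    intro c hc'
    by_contra hlt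
    have := hc c (fun h => hlt h.le)
    rw [if_neg (by rintro rfl; exact hlt le_rfl)] at this
    exact MvPolynomial.mem_support_iff.1 hc' this

theorem degree_normalForm_mul {D : GPresentation K N} (hD : D.IsGAlgebra)
    {m : MonomialOrder (Fin N)} (hm : D.IsAdmissible m) {f g : D.Alg} (hf : f ≠ 0) (hg : g ≠ 0) :
    f * g ≠ 0 ∧ m.degree (D.normalForm (f * g)) =
      m.degree (D.normalForm f) + m.degree (D.normalForm g) := by
  have hf' := sub_leading_mem_filt hD m f
  have hg' := sub_leading_mem_filt hD m g
  have hlf : m.leadingCoeff (D.normalForm f) ≠ 0 := by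
    rwa [ne_eq, m.leadingCoeff_eq_zero_iff, normalForm_eq_zero_iff hD]
  have hlg : m.leadingCoeff (D.normalForm g) ≠ 0 := by
    rwa [ne_eq, m.leadingCoeff_eq_zero_iff, normalForm_eq_zero_iff hD]
  set a := m.degree (D.normalForm f)
  set b := m.degree (D.normalForm g)
  set c := m.leadingCoeff (D.normalForm f)
  set d := m.leadingCoeff (D.normalForm g)
  obtain ⟨κ, hκ, h⟩ := mon_mul_mon hD hm a b
  refine degree_normalForm_of_sub_mem_filt hD (mul_ne_zero (mul_ne_zero hlf hlg) hκ) ?_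
  -- Splitting off both leading terms leaves three errors, each strictly below `a + b`.
  have h1 : f * g - (c * d * κ) • D.mon (a + b) =
      (c * d) • (D.mon a * D.mon b - κ • D.mon (a + b)) +
      ((f - c • D.mon a) * g + (c • D.mon a) * (g - d • D.mon b)) := by
    simp only [sub_mul, mul_sub, smul_mul_assoc, mul_smul_comm]
    module
  rw [h1]
  refine add_mem (Submodule.smul_mem _ _ h) (add_mem ?_ ?_)
  · refine mul_mem_filt hD hm (t := {x | m.toSyn x ≤ m.toSyn b}) ?_ hf'
      ((mem_filt_iff hD).2 fun x hx => m.le_degree hx)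
    intro x hx y hy z hz
    refine hz.trans_lt ?_
    rw [map_add, map_add]
    exact add_lt_add_of_lt_of_le hx hy
  · refine mul_mem_filt hD hm (s := {a}) ?_
      (Submodule.smul_mem _ _ (mon_mem_filt hD (Set.mem_singleton a))) hg'
    rintro x rfl y hy z hz
    refine hz.trans_lt ?_
    rw [map_add, map_add]
    exact add_lt_add_right hy _

theorem noZeroDivisors {D : GPresentation K N} (hD : D.IsGAlgebra) : NoZeroDivisors D.Alg where
  eq_zero_or_eq_zero_of_mul_eq_zero {f g} h := by
    obtain ⟨m, hm⟩ := hD.exists_admissible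
    by_contra! h'
    exact (degree_normalForm_mul hD hm h'.1 h'.2).1 h

theorem nontrivial {D : GPresentation K N} (hD : D.IsGAlgebra) : Nontrivial D.Alg :=
  (normalFormEquiv hD).toEquiv.nontrivial

end

end GPresentation

namespace GPresentation

noncomputable section

open Finsupp FreeMonoid

/-! ### Linear dependence over left Ore domains -/

theorem exists_ne_zero_sum_mul_eq_zero {S : Type*} [Ring S] [Nontrivial S] [NoZeroDivisors S]
    (hS : ∀ f g : S, g ≠ 0 → ∃ u v : S, u ≠ 0 ∧ u * f = v * g) :
    ∀ (q : ℕ) (v : Fin (q + 1) → Fin q → S),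
      ∃ c : Fin (q + 1) → S, c ≠ 0 ∧ ∀ j, ∑ i, c i * v i j = 0
  | 0, _ => ⟨1, one_ne_zero, fun j => j.elim0⟩
  | q + 1, v => by
    by_cases h : ∀ i, v i (Fin.last q) = 0
    · obtain ⟨c, hc, hcv⟩ := exists_ne_zero_sum_mul_eq_zero hS q fun i j => v i.castSucc j.castSucc
      refine ⟨Fin.snoc c 0, fun h0 => hc (funext fun i => ?_), fun j => ?_⟩
      · simpa using congrFun h0 i.castSucc
      · rw [Fin.sum_univ_castSucc]
        cases j using Fin.lastCases with
        | last => simp [h]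
        | cast j => simpa using hcv j
    · push Not at h
      obtain ⟨i₀, hi₀⟩ := h
      -- Elimination of the last column: Ore multipliers make each last entry a left multiple of the
      -- pivot.
      choose a b ha hab using fun k : Fin (q + 1) =>
        hS (v (i₀.succAbove k) (Fin.last q)) (v i₀ (Fin.last q)) hi₀
      obtain ⟨c, hc, hcv⟩ := exists_ne_zero_sum_mul_eq_zero hS q fun k j =>
        a k * v (i₀.succAbove k) j.castSucc - b k * v i₀ j.castSucc
      -- The pivot row collects everything subtracted during elimination; the relation stays
      -- nontrivial since `a k ≠ 0`.
      refine ⟨i₀.insertNth (-∑ k, c k * b k) fun k => c k * a k, fun h0 => hc ?_, fun j => ?_⟩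
      · funext k
        have := congrFun h0 (i₀.succAbove k)
        simpa [ha k] using this
      · have key : ∑ k, c k * (a k * v (i₀.succAbove k) j - b k * v i₀ j) = 0 := by
          cases j using Fin.lastCases with
          | last => simp [hab]
          | cast j => exact hcv j
        rw [Fin.sum_univ_succAbove _ i₀]
        simp only [Fin.insertNth_apply_same, Fin.insertNth_apply_succAbove]
        rw [← key, neg_mul, Finset.sum_mul, ← Finset.sum_neg_distrib, ← Finset.sum_add_distrib]
        refine Finset.sum_congr rfl fun k _ => ?_
        noncomm_ring

section LastVariable

variable {K : Type*} [Field K] {n : ℕ}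

/-! ### The degree in the last variable -/

/-- If `c` had the larger ∂-exponent, it would be divisible by `∂ ^ (a_∂ + 1)`, which exceeds `a`
because ∂ exceeds the ∂-free part of `a`. -/
theorem DelIsLarge.last_le {m : MonomialOrder (Fin (n + 1))} (hdel : DelIsLarge m)
    {a c : Fin (n + 1) →₀ ℕ} (h : m.toSyn c ≤ m.toSyn a) : c (Fin.last n) ≤ a (Fin.last n) := by
  by_contra! hlt
  refine absurd h (not_le.2 ?_)
  have h1 := hdel (a.erase (Fin.last n)) (by simp)
  have h2 : single (Fin.last n) (a (Fin.last n) + 1) ≤ c := by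
    intro i
    by_cases hi : i = Fin.last n
    · subst hi
      simpa using hlt
    · simp [Finsupp.single_eq_of_ne hi]
  refine lt_of_lt_of_le ?_ (m.toSyn_monotone h2)
  conv_lhs => rw [← Finsupp.single_add_erase (Fin.last n) a]
  rw [Finsupp.single_add, map_add, map_add]
  exact add_lt_add_right h1 _

/-- The elements whose degree in the last variable is less than `k`. -/
abbrev delFilt {D : GPresentation K (n + 1)} (hD : D.IsGAlgebra) (k : ℕ) : Submodule K D.Alg :=
  filt hD {a | a (Fin.last n) < k}

theorem mul_mem_delFilt {D : GPresentation K (n + 1)} (hD : D.IsGAlgebra)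
    {m : MonomialOrder (Fin (n + 1))} (hm : D.IsAdmissible m) (hdel : DelIsLarge m) {i k : ℕ}
    {f g : D.Alg} (hf : f ∈ delFilt hD (i + 1)) (hg : g ∈ delFilt hD k) :
    f * g ∈ delFilt hD (i + k) := by
  refine mul_mem_filt hD hm (fun a ha b hb c hc => ?_) hf hg
  have := hdel.last_le hc
  simp only [Set.mem_ofPred_eq, Finsupp.add_apply] at *
  omega

theorem mem_delFilt_iff {D : GPresentation K (n + 1)} (hD : D.IsGAlgebra)
    {m : MonomialOrder (Fin (n + 1))} (hdel : DelIsLarge m) {k : ℕ} {f : D.Alg} (hf : f ≠ 0) :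
    f ∈ delFilt hD k ↔ m.degree (D.normalForm f) (Fin.last n) < k := by
  rw [mem_filt_iff]
  constructor
  · exact fun h => h _ (m.degree_mem_support (by rwa [ne_eq, normalForm_eq_zero_iff hD]))
  · exact fun h a ha => (hdel.last_le (m.le_degree ha)).trans_lt h

theorem delFilt_zero {D : GPresentation K (n + 1)} (hD : D.IsGAlgebra) {f : D.Alg} :
    f ∈ delFilt hD 0 ↔ f = 0 := by
  rw [mem_filt_iff, ← normalForm_eq_zero_iff hD, ← MvPolynomial.support_eq_empty,
    Finset.eq_empty_iff_forall_notMem]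
  simp

theorem stdWord_single {N : ℕ} (i : Fin N) (k : ℕ) : stdWord (single i k) = of i ^ k := by
  have h : ¬ HasDescent (of i ^ k) := by
    rw [not_hasDescent_iff, toList_of_pow]
    simp [List.pairwise_replicate]
  rw [eq_stdWord_of_not_hasDescent h]
  simp [expo]

theorem mon_single (D : GPresentation K (n + 1)) (i : Fin (n + 1)) (k : ℕ) :
    D.mon (single i k) = D.x i ^ k := by
  rw [mon, ← word_stdWord, stdWord_single, word, map_pow, FreeMonoid.lift_eval_of, map_pow, x]

theorem mon_eq (D : GPresentation K (n + 1)) (a : Fin (n + 1) →₀ ℕ) :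
    D.mon a = (List.ofFn fun i : Fin n => D.x i.castSucc ^ a i.castSucc).prod *
      D.x (Fin.last n) ^ a (Fin.last n) := by
  rw [mon, stdMonomial, List.ofFn_succ', List.concat_eq_append, List.prod_append]
  simp [map_list_prod, List.map_ofFn, x, Function.comp_def]

theorem mon_mem_coeffAlg (D : GPresentation K (n + 1)) {a : Fin (n + 1) →₀ ℕ}
    (ha : a (Fin.last n) = 0) : D.mon a ∈ D.coeffAlg := by
  rw [mon_eq, ha, pow_zero, mul_one]
  refine list_prod_mem fun y hy => ?_
  obtain ⟨i, rfl⟩ := (List.mem_ofFn' _ _).1 hy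
  exact pow_mem (Algebra.subset_adjoin (Set.mem_range_self i)) _

theorem mon_eq_mon_erase_mul (D : GPresentation K (n + 1)) (a : Fin (n + 1) →₀ ℕ) :
    D.mon a = D.mon (a.erase (Fin.last n)) * D.x (Fin.last n) ^ a (Fin.last n) := by
  rw [mon_eq, mon_eq]
  simp [Finsupp.erase_ne, Fin.castSucc_ne_last]

theorem one_mem_delFilt {D : GPresentation K (n + 1)} (hD : D.IsGAlgebra) :
    (1 : D.Alg) ∈ delFilt hD 1 := by
  have : D.mon (single (Fin.last n) 0) ∈ delFilt hD 1 := mon_mem_filt hD (by simp)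
  rwa [mon_single, pow_zero] at this

theorem mem_delFilt_of_mem_coeffAlg {D : GPresentation K (n + 1)} (hD : D.IsGAlgebra)
    {m : MonomialOrder (Fin (n + 1))} (hm : D.IsAdmissible m) (hdel : DelIsLarge m) {f : D.Alg}
    (hf : f ∈ D.coeffAlg) : f ∈ delFilt hD 1 := by
  induction hf using Algebra.adjoin_induction with
  | mem y hy =>
    obtain ⟨i, rfl⟩ := hy
    simp only
    rw [← pow_one (D.x i.castSucc), ← mon_single]
    exact mon_mem_filt hD (by simp [Finsupp.single_eq_of_ne (Fin.castSucc_ne_last i).symm])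
  | algebraMap r =>
    rw [Algebra.algebraMap_eq_smul_one]
    exact Submodule.smul_mem _ _ (one_mem_delFilt hD)
  | add y z _ _ hy hz => exact add_mem hy hz
  | mul y z _ _ hy hz => simpa using mul_mem_delFilt hD hm hdel (i := 0) hy hz

/-- As ∂ comes last in standard monomials, the top part in ∂ has its coefficient from `A_*` on the
left. -/
theorem exists_sub_mul_pow_mem_delFilt {D : GPresentation K (n + 1)} (hD : D.IsGAlgebra) {k : ℕ}
    {f : D.Alg} (hf : f ∈ delFilt hD (k + 1)) :
    ∃ a ∈ D.coeffAlg, f - a * D.x (Fin.last n) ^ k ∈ delFilt hD k := by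
  rw [delFilt, filt_eq_span] at hf
  induction hf using Submodule.span_induction with
  | zero => exact ⟨0, zero_mem _, by simp⟩
  | add y z _ _ hy hz =>
    obtain ⟨a, ha, hya⟩ := hy
    obtain ⟨b, hb, hzb⟩ := hz
    refine ⟨a + b, add_mem ha hb, ?_⟩
    rw [add_mul, add_sub_add_comm]
    exact add_mem hya hzb
  | smul c y _ hy =>
    obtain ⟨a, ha, hya⟩ := hy
    refine ⟨c • a, Subalgebra.smul_mem _ ha c, ?_⟩
    rw [smul_mul_assoc, ← smul_sub]
    exact Submodule.smul_mem _ _ hya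
  | mem y hy =>
    obtain ⟨a, ha, rfl⟩ := hy
    rcases (Nat.lt_succ_iff.1 ha).lt_or_eq with h | h
    · exact ⟨0, zero_mem _, by simpa using mon_mem_filt hD h⟩
    · refine ⟨D.mon (a.erase (Fin.last n)), mon_mem_coeffAlg D (by simp), ?_⟩
      rw [mon_eq_mon_erase_mul D a, h, sub_self]
      exact zero_mem _

theorem degree_normalForm_x_pow {D : GPresentation K (n + 1)} (hD : D.IsGAlgebra)
    (m : MonomialOrder (Fin (n + 1))) (i : Fin (n + 1)) (k : ℕ) :
    m.degree (D.normalForm (D.x i ^ k)) = single i k := by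
  classical
  rw [← mon_single, normalForm_mon hD, m.degree_monomial, if_neg one_ne_zero]

theorem x_pow_ne_zero {D : GPresentation K (n + 1)} (hD : D.IsGAlgebra) (i : Fin (n + 1)) (k : ℕ) :
    D.x i ^ k ≠ 0 := by
  rw [← mon_single, ne_eq, ← normalForm_eq_zero_iff hD, normalForm_mon hD,
    MvPolynomial.monomial_eq_zero]
  exact one_ne_zero

theorem mem_denominators_iff' {D : GPresentation K (n + 1)} (hD : D.IsGAlgebra) {a : D.Alg} :
    a ∈ D.denominators ↔ a ∈ D.coeffAlg ∧ a ≠ 0 :=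
  have := nontrivial hD
  have := noZeroDivisors hD
  mem_denominators_iff D a

/-- Division with remainder, up to a factor from the coefficient algebra. -/
theorem exists_mul_sub_mul_mem_delFilt {D : GPresentation K (n + 1)} (hD : D.IsGAlgebra)
    {m : MonomialOrder (Fin (n + 1))} (hm : D.IsAdmissible m) (hdel : DelIsLarge m)
    [OreLocalization.OreSet D.denominators] {d : ℕ} {f g : D.Alg} (hf : f ∈ delFilt hD (d + 1))
    (hg : g ≠ 0) (hgd : m.degree (D.normalForm g) (Fin.last n) ≤ d) :
    ∃ a ∈ D.denominators, ∃ q, a * f - q * g ∈ delFilt hD d := by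
  obtain ⟨k, rfl⟩ := Nat.exists_eq_add_of_le' hgd
  set l := m.degree (D.normalForm g) (Fin.last n) with hl
  -- Multiplying by `∂ ^ k` raises the divisor to ∂-degree `d`.
  set h := D.x (Fin.last n) ^ k * g with hh
  obtain ⟨hh0, hdeg⟩ := degree_normalForm_mul hD hm (x_pow_ne_zero hD (Fin.last n) k) hg
  have hdl : m.degree (D.normalForm h) (Fin.last n) = k + l := by
    rw [hh, hdeg, degree_normalForm_x_pow hD, Finsupp.add_apply, single_eq_same]
  obtain ⟨a, ha, hfa⟩ := exists_sub_mul_pow_mem_delFilt hD hf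
  obtain ⟨b, hb, hhb⟩ := exists_sub_mul_pow_mem_delFilt hD
    ((mem_delFilt_iff hD hdel hh0).2 (hdl.trans_lt (Nat.lt_succ_self _)))
  have hb0 : b ≠ 0 := by
    rintro rfl
    rw [zero_mul, sub_zero, mem_delFilt_iff hD hdel hh0] at hhb
    exact absurd hdl hhb.ne
  let b' : D.denominators := ⟨b, (mem_denominators_iff' hD).2 ⟨hb, hb0⟩⟩
  have hore := OreLocalization.ore_eq a b'
  set s := OreLocalization.oreDenom a b'
  set r := OreLocalization.oreNum a b'
  have hs := mem_delFilt_of_mem_coeffAlg hD hm hdel ((mem_denominators_iff' hD).1 s.2).1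
  -- The Ore condition places `r` only in `R_*`. Comparing ∂-degrees in `r * b = s * a` shows that
  -- `r` is free of ∂, so multiplying by it does not raise degrees.
  have hr : r ∈ delFilt hD 1 := by
    by_cases hr0 : r = 0
    · rw [hr0]
      exact zero_mem _
    obtain ⟨h1, h2⟩ := degree_normalForm_mul hD hm hr0 hb0
    have h3 : r * b ∈ delFilt hD 1 := by
      rw [show r * b = s * a from hore.symm]
      simpa using mul_mem_delFilt hD hm hdel (i := 0) hs
        (mem_delFilt_of_mem_coeffAlg hD hm hdel ha)
    rw [mem_delFilt_iff hD hdel h1, h2, Finsupp.add_apply] at h3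
    rw [mem_delFilt_iff hD hdel hr0]
    omega
  refine ⟨s, s.2, r * D.x (Fin.last n) ^ k, ?_⟩
  have h1 : s * f - r * D.x (Fin.last n) ^ k * g =
      s * (f - a * D.x (Fin.last n) ^ (k + l)) - r * (h - b * D.x (Fin.last n) ^ (k + l)) := by
    have : (s : D.Alg) * a = r * b := hore
    rw [hh, mul_sub, mul_sub, ← mul_assoc, ← mul_assoc, ← mul_assoc, this]
    abel
  rw [h1]
  refine sub_mem ?_ ?_
  · simpa using mul_mem_delFilt hD hm hdel (i := 0) hs hfa
  · simpa using mul_mem_delFilt hD hm hdel (i := 0) hr hhb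

/-- The algebra is a left Ore domain. -/
theorem exists_mul_eq_mul {D : GPresentation K (n + 1)} (hD : D.IsGAlgebra)
    {m : MonomialOrder (Fin (n + 1))} (hm : D.IsAdmissible m) (hdel : DelIsLarge m)
    [OreLocalization.OreSet D.denominators] (f g : D.Alg) (hg : g ≠ 0) :
    ∃ u v : D.Alg, u ≠ 0 ∧ u * f = v * g := by
  have := nontrivial hD
  have := noZeroDivisors hD
  by_cases hf : f = 0
  · exact ⟨1, 0, one_ne_zero, by simp [hf]⟩
  -- The Euclidean algorithm: the entry of larger ∂-degree is replaced by its remainder, up to a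
  -- denominator.
  induction hs : m.degree (D.normalForm f) (Fin.last n) + m.degree (D.normalForm g) (Fin.last n)
    using Nat.strong_induction_on generalizing f g with
  | _ s ih =>
  subst hs
  rcases le_total (m.degree (D.normalForm g) (Fin.last n))
    (m.degree (D.normalForm f) (Fin.last n)) with hle | hle
  · obtain ⟨a, ha, q, hr⟩ := exists_mul_sub_mul_mem_delFilt hD hm hdel
      ((mem_delFilt_iff hD hdel hf).2 (Nat.lt_succ_self _)) hg hle
    have ha0 := ((mem_denominators_iff' hD).1 ha).2
    by_cases hr0 : a * f - q * g = 0
    · exact ⟨a, q, ha0, sub_eq_zero.1 hr0⟩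
    rw [mem_delFilt_iff hD hdel hr0] at hr
    obtain ⟨u, v, hu, huv⟩ := ih _ (by omega) _ g hg hr0 rfl
    refine ⟨u * a, v + u * q, mul_ne_zero hu ha0, ?_⟩
    rw [add_mul, ← huv]
    simp only [mul_sub, mul_assoc]
    abel
  · obtain ⟨a, ha, q, hr⟩ := exists_mul_sub_mul_mem_delFilt hD hm hdel
      ((mem_delFilt_iff hD hdel hg).2 (Nat.lt_succ_self _)) hf hle
    have ha0 := ((mem_denominators_iff' hD).1 ha).2
    by_cases hr0 : a * g - q * f = 0
    · refine ⟨q, a, ?_, (sub_eq_zero.1 hr0).symm⟩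
      rintro rfl
      rw [zero_mul, sub_zero] at hr0
      exact mul_ne_zero ha0 hg hr0
    rw [mem_delFilt_iff hD hdel hr0] at hr
    obtain ⟨u, v, hu, huv⟩ := ih _ (by omega) f _ hr0 hf rfl
    have h1 : (u + v * q) * f = v * a * g := by
      rw [add_mul, huv]
      simp only [mul_sub, mul_assoc]
      abel
    -- If the multiplier vanished, then `v * a * g = 0`, so `v = 0` and `u * f = 0`, contradicting
    -- `u, f ≠ 0`.
    refine ⟨u + v * q, v * a, fun h0 => ?_, h1⟩
    rw [h0, zero_mul, eq_comm, mul_eq_zero, mul_eq_zero] at h1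
    have hv : v = 0 := (h1.resolve_right hg).resolve_right ha0
    rw [hv, zero_mul] at huv
    exact mul_ne_zero hu hf huv

end LastVariable

variable {K : Type*} [Field K]

/-! ### Leading monomials of vectors -/

section LeadingMonomials

variable {N q : ℕ}

theorem key_le_key {m : MonomialOrder (Fin N)} {k l : Fin q} {a c : Fin N →₀ ℕ} :
    key m k a ≤ key m l c ↔ k < l ∨ k = l ∧ m.toSyn a ≤ m.toSyn c := by
  rw [key, key, WithBot.coe_le_coe, Prod.Lex.toLex_le_toLex]

theorem key_inj {m : MonomialOrder (Fin N)} {k l : Fin q} {a c : Fin N →₀ ℕ} :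
    key m k a = key m l c ↔ k = l ∧ a = c := by
  rw [key, key, WithBot.coe_inj, toLex_inj, Prod.mk.injEq, m.toSyn.injective.eq_iff]

theorem exists_last_ne_zero {S : Type*} [Zero S] {v : Fin q → S} (hv : v ≠ 0) :
    ∃ k, v k ≠ 0 ∧ ∀ j, k < j → v j = 0 := by
  classical
  have hne : (Finset.univ.filter fun k => v k ≠ 0).Nonempty := by
    obtain ⟨k, hk⟩ := Function.ne_iff.1 hv
    exact ⟨k, by simpa using hk⟩
  refine ⟨_, (Finset.mem_filter.1 (Finset.max'_mem _ hne)).2, fun j hj => ?_⟩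
  by_contra h
  exact absurd (Finset.le_max' _ j (by simpa using h)) (not_le.2 hj)

theorem lm_eq_key {D : GPresentation K N} (hD : D.IsGAlgebra) (m : MonomialOrder (Fin N))
    {v : Fin q → D.Alg} {k : Fin q} (hk : v k ≠ 0) (hv : ∀ j, k < j → v j = 0) :
    D.lm m v = key m k (m.degree (D.normalForm (v k))) := by
  refine le_antisymm (Finset.sup_le fun j _ => Finset.sup_le fun a ha => key_le_key.2 ?_) ?_
  · rcases lt_trichotomy j k with h | rfl | h
    · exact .inl h
    · exact .inr ⟨rfl, m.le_degree ha⟩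
    · rw [hv j h, (normalForm_eq_zero_iff hD).2 rfl] at ha
      simp at ha
  · have h1 : m.degree (D.normalForm (v k)) ∈ (D.normalForm (v k)).support :=
      m.degree_mem_support (by rwa [ne_eq, normalForm_eq_zero_iff hD])
    exact (Finset.le_sup (f := fun a => key m k a) h1).trans
      (Finset.le_sup (f := fun k => (D.normalForm (v k)).support.sup fun a => key m k a)
        (Finset.mem_univ k))

theorem exists_lm_eq_key {D : GPresentation K N} (hD : D.IsGAlgebra) (m : MonomialOrder (Fin N))
    {v : Fin q → D.Alg} (hv : v ≠ 0) :
    ∃ k, v k ≠ 0 ∧ (∀ j, k < j → v j = 0) ∧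
      D.lm m v = key m k (m.degree (D.normalForm (v k))) :=
  let ⟨k, hk, hkv⟩ := exists_last_ne_zero hv
  ⟨k, hk, hkv, lm_eq_key hD m hk hkv⟩

theorem lpos_of_lm_eq_key {D : GPresentation K N} {m : MonomialOrder (Fin N)}
    {v : Fin q → D.Alg} {k : Fin q} {a : Fin N →₀ ℕ} (h : D.lm m v = key m k a) :
    D.lpos m v = k := by
  rw [lpos, h]
  rfl

theorem lpos_eq_coe_iff {D : GPresentation K N} (hD : D.IsGAlgebra) {m : MonomialOrder (Fin N)}
    {v : Fin q → D.Alg} (hv : v ≠ 0) {i : Fin q} :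
    D.lpos m v = i ↔ v i ≠ 0 ∧ ∀ j, i < j → v j = 0 := by
  constructor
  · intro h
    obtain ⟨k, hk, hkv, hlm⟩ := exists_lm_eq_key hD m hv
    rw [lpos_of_lm_eq_key hlm, WithBot.coe_inj] at h
    exact h ▸ ⟨hk, hkv⟩
  · rintro ⟨h1, h2⟩
    exact lpos_of_lm_eq_key (lm_eq_key hD m h1 h2)

theorem lm_eq_key_of_lpos_eq {D : GPresentation K N} (hD : D.IsGAlgebra)
    {m : MonomialOrder (Fin N)} {v : Fin q → D.Alg} (hv : v ≠ 0) {i : Fin q}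
    (h : D.lpos m v = i) : D.lm m v = key m i (m.degree (D.normalForm (v i))) :=
  have h := (lpos_eq_coe_iff hD hv).1 h
  lm_eq_key hD m h.1 h.2

theorem exists_lpos_eq_coe {D : GPresentation K N} (hD : D.IsGAlgebra) (m : MonomialOrder (Fin N))
    {v : Fin q → D.Alg} (hv : v ≠ 0) : ∃ i : Fin q, D.lpos m v = i :=
  let ⟨k, _, _, h⟩ := exists_lm_eq_key hD m hv
  ⟨k, lpos_of_lm_eq_key h⟩

theorem lpos_mono {D : GPresentation K N} {m : MonomialOrder (Fin N)} {v w : Fin q → D.Alg}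
    (h : D.lm m v ≤ D.lm m w) : D.lpos m v ≤ D.lpos m w :=
  WithBot.monotone_map_iff.2 Prod.Lex.monotone_fst_ofLex h

/-- A shared leading monomial would be a monomial of one element divisible by the leading monomial
of another. -/
theorem IsReducedGroebnerBasis.lm_injOn {D : GPresentation K N} (hD : D.IsGAlgebra)
    {m : MonomialOrder (Fin N)} {G : Finset (Fin q → D.Alg)}
    {L : Submodule D.Alg (Fin q → D.Alg)} (hG : D.IsReducedGroebnerBasis m G L) :
    Set.InjOn (D.lm m) (G : Set (Fin q → D.Alg)) := by
  intro g hg h hh hgh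
  by_contra hne
  obtain ⟨k, hk, hkv, hlm⟩ := exists_lm_eq_key hD m (hG.ne_zero g hg)
  refine hG.reduced g hg h hh (Ne.symm hne) k _ _ (hgh.symm.trans hlm) (m.degree_mem_support ?_)
    le_rfl
  rwa [ne_eq, normalForm_eq_zero_iff hD]

theorem IsReducedGroebnerBasis.exists_mem_block {D : GPresentation K N} (hD : D.IsGAlgebra)
    {m : MonomialOrder (Fin N)} {G : Finset (Fin q → D.Alg)}
    {L : Submodule D.Alg (Fin q → D.Alg)} (hG : D.IsReducedGroebnerBasis m G L)
    {f : Fin q → D.Alg} (hf : f ∈ L) {i : Fin q} (hi : f i ≠ 0) (hfi : ∀ j, i < j → f j = 0) :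
    ∃ g ∈ D.block m G i,
      m.degree (D.normalForm (g i)) ≤ m.degree (D.normalForm (f i)) := by
  obtain ⟨g, hg, k, a, b, hga, hfb, hab⟩ := hG.exists_dvd f hf (fun h => hi (by simp [h]))
  rw [lm_eq_key hD m hi hfi, key_inj] at hfb
  obtain ⟨rfl, rfl⟩ := hfb
  have hpos := lpos_of_lm_eq_key hga
  rw [lm_eq_key_of_lpos_eq hD (hG.ne_zero g hg) hpos, key_inj] at hga
  exact ⟨g, ⟨hg, hpos⟩, hga.2 ▸ hab⟩

/-- The matrix of the elements of a finite set, sorted by their leading monomials. -/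
theorem exists_sorted_matrix {D : GPresentation K N} {m : MonomialOrder (Fin N)}
    {G : Finset (Fin q → D.Alg)} (hG : Set.InjOn (D.lm m) (G : Set (Fin q → D.Alg))) :
    ∃ (l : ℕ) (B : Matrix (Fin l) (Fin q) D.Alg),
      Set.range B.row = (G : Set (Fin q → D.Alg)) ∧ StrictMono fun r => D.lm m (B.row r) := by
  classical
  let e := (G.image (D.lm m)).orderEmbOfFin rfl
  have he : ∀ r, ∃ g ∈ G, D.lm m g = e r := fun r =>
    Finset.mem_image.1 (Finset.orderEmbOfFin_mem _ rfl r)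
  choose B hBG hB using he
  refine ⟨_, Matrix.of B, ?_, fun r s hrs => ?_⟩
  · ext g
    constructor
    · rintro ⟨r, rfl⟩
      exact hBG r
    · intro hg
      have h1 : D.lm m g ∈ Set.range e := by
        rw [Finset.range_orderEmbOfFin]
        exact Finset.mem_coe.2 (Finset.mem_image_of_mem _ hg)
      obtain ⟨r, hr⟩ := h1
      exact ⟨r, hG (hBG r) hg ((hB r).trans hr)⟩
  · change D.lm m (B r) < D.lm m (B s)
    rw [hB, hB]
    exact e.strictMono hrs

end LeadingMonomials

/-! ### Vectors over the localization -/

section Localization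

variable {n q : ℕ} {D : GPresentation K (n + 1)}

theorem deg_of_lpos_eq (hD : D.IsGAlgebra) {m : MonomialOrder (Fin (n + 1))}
    {v : Fin q → D.Alg} (hv : v ≠ 0) {i : Fin q} (h : D.lpos m v = i) :
    D.deg m v = (m.degree (D.normalForm (v i)) (Fin.last n) : ℕ) := by
  rw [deg, lm_eq_key_of_lpos_eq hD hv h, key, WithBot.map_coe, Nat.cast_withBot]
  simp

theorem deg_mono (hD : D.IsGAlgebra) {m : MonomialOrder (Fin (n + 1))} (hdel : DelIsLarge m)
    {v w : Fin q → D.Alg} (hv : v ≠ 0) (hw : w ≠ 0) {i : Fin q} (hvi : D.lpos m v = i)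
    (hwi : D.lpos m w = i) (h : D.lm m v ≤ D.lm m w) : D.deg m v ≤ D.deg m w := by
  rw [deg_of_lpos_eq hD hv hvi, deg_of_lpos_eq hD hw hwi, Nat.cast_le]
  rw [lm_eq_key_of_lpos_eq hD hv hvi, lm_eq_key_of_lpos_eq hD hw hwi, key_le_key] at h
  exact hdel.last_le (h.resolve_left (lt_irrefl i)).2

/-! ### Passing from `R_*`-submodules to `R`-submodules -/

variable [OreLocalization.OreSet D.denominators]

/-- `toOLGAED` as a ring homomorphism. -/
def toOLGAEDHom (D : GPresentation K (n + 1)) [OreLocalization.OreSet D.denominators] :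
    D.Alg →+* D.OLGAED := OreLocalization.numeratorRingHom

theorem toOLGAEDHom_apply (f : D.Alg) : D.toOLGAEDHom f = D.toOLGAED f := rfl

theorem toOLGAED_injective (hD : D.IsGAlgebra) : Function.Injective D.toOLGAED := by
  have := nontrivial hD
  have := noZeroDivisors hD
  refine OreLocalization.numeratorHom_inj fun a ha => ?_
  rw [mem_nonZeroDivisorsLeft_iff]
  exact fun b hb => (mul_eq_zero.1 hb).resolve_left ((mem_denominators_iff' hD).1 ha).2

theorem isUnit_toOLGAED {a : D.Alg} (ha : a ∈ D.denominators) : IsUnit (D.toOLGAED a) :=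
  OreLocalization.numerator_isUnit (⟨a, ha⟩ : D.denominators)

/-- `toOLGAED`, applied to the entries of a vector. -/
def mapVec (D : GPresentation K (n + 1)) [OreLocalization.OreSet D.denominators] (q : ℕ) :
    (Fin q → D.Alg) →ₛₗ[D.toOLGAEDHom] (Fin q → D.OLGAED) where
  toFun v j := D.toOLGAED (v j)
  map_add' v w := funext fun j => map_add D.toOLGAEDHom (v j) (w j)
  map_smul' a v := funext fun j => map_mul D.toOLGAEDHom a (v j)

theorem mem_of_smul_mem {P : Submodule D.OLGAED (Fin q → D.OLGAED)} {a : D.Alg}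
    (ha : a ∈ D.denominators) {x : Fin q → D.OLGAED} (h : D.toOLGAED a • x ∈ P) : x ∈ P := by
  obtain ⟨u, hu⟩ := isUnit_toOLGAED ha
  rw [← hu] at h
  have := P.smul_mem (↑u⁻¹ : D.OLGAED) h
  rwa [smul_smul, Units.inv_mul, one_smul] at this

theorem mapVec_mem {P : Submodule D.OLGAED (Fin q → D.OLGAED)} {s : Set (Fin q → D.Alg)}
    (h : ∀ v ∈ s, D.mapVec q v ∈ P) {v : Fin q → D.Alg} (hv : v ∈ Submodule.span D.Alg s) :
    D.mapVec q v ∈ P := by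
  have : Submodule.span D.Alg s ≤ P.comap (D.mapVec q) := Submodule.span_le.2 h
  exact this hv

/-- A submodule is generated, over the localization, by elements whose degrees are minimal among
the elements of the submodule with the same leading position. -/
theorem mapVec_mem_span_of_forall (hD : D.IsGAlgebra) {m : MonomialOrder (Fin (n + 1))}
    (hm : D.IsAdmissible m) (hdel : DelIsLarge m) {L : Submodule D.Alg (Fin q → D.Alg)}
    {b : Fin q → Fin q → D.Alg} (hbL : ∀ i, b i ∈ L) (hb0 : ∀ i, b i i ≠ 0)
    (hb : ∀ i j, i < j → b i j = 0)
    (hmin : ∀ f ∈ L, ∀ i, f i ≠ 0 → (∀ j, i < j → f j = 0) →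
      m.degree (D.normalForm (b i i)) (Fin.last n) ≤
        m.degree (D.normalForm (f i)) (Fin.last n))
    {f : Fin q → D.Alg} (hf : f ∈ L) :
    D.mapVec q f ∈ Submodule.span D.OLGAED (Set.range fun i => D.mapVec q (b i)) := by
  suffices h : ∀ k : ℕ, ∀ f ∈ L, (∀ j : Fin q, k ≤ j → f j = 0) →
      D.mapVec q f ∈ Submodule.span D.OLGAED (Set.range fun i => D.mapVec q (b i)) from
    h q f hf fun j hj => absurd j.2 (not_lt.2 hj)
  intro k
  induction k with
  | zero =>
    intro f _ h0
    have : f = 0 := funext fun j => h0 j (Nat.zero_le _)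
    rw [this, map_zero]
    exact zero_mem _
  | succ k ihk =>
    intro f hf h0
    by_cases hk : k < q
    swap
    · exact ihk f hf fun j hj => absurd j.2 (by omega)
    let i : Fin q := ⟨k, hk⟩
    -- Inner induction on a strict bound for the ∂-degree in column `i`; the bound 0 means that the
    -- entry is zero.
    obtain ⟨d, hd⟩ : ∃ d, f i ∈ delFilt hD d := by
      by_cases hfi : f i = 0
      · exact ⟨0, hfi ▸ zero_mem _⟩
      · exact ⟨_, (mem_delFilt_iff hD hdel hfi).2 (Nat.lt_succ_self _)⟩
    have hlast : ∀ f : Fin q → D.Alg, (∀ j : Fin q, k + 1 ≤ j → f j = 0) → f i = 0 →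
        ∀ j : Fin q, k ≤ j → f j = 0 := by
      intro f h0 hfi j hj
      rcases hj.lt_or_eq with h | h
      · exact h0 j h
      · rwa [show j = i from Fin.ext h.symm]
    induction d generalizing f with
    | zero => exact ihk f hf (hlast f h0 ((delFilt_zero hD).1 hd))
    | succ d ihd =>
      by_cases hfi : f i = 0
      · exact ihk f hf (hlast f h0 hfi)
      -- Minimality is what permits division by `b i i`. The remainder `a • f - c • b i` lies in `L`
      -- again, and `a` is invertible over the localization.
      have h1 := hmin f hf i hfi fun j hj => h0 j hj
      have h2 := (mem_delFilt_iff hD hdel hfi).1 hd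
      obtain ⟨a, ha, c, hac⟩ := exists_mul_sub_mul_mem_delFilt hD hm hdel hd (hb0 i)
        (h1.trans (Nat.lt_succ_iff.1 h2))
      have h3 := ihd (a • f - c • b i) (sub_mem (L.smul_mem _ hf) (L.smul_mem _ (hbL i)))
        (fun j hj => by simp [h0 j hj, hb i j hj]) (by simpa using hac)
      have h4 := add_mem h3 (Submodule.smul_mem _ (D.toOLGAEDHom c)
        (Submodule.subset_span (Set.mem_range_self (f := fun i => D.mapVec q (b i)) i)))
      rw [← LinearMap.map_smulₛₗ, ← map_add, sub_add_cancel, LinearMap.map_smulₛₗ] at h4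
      exact mem_of_smul_mem ha h4

theorem IsFractionFreeForm.exists_smul_row {p : ℕ}
    {M : Matrix (Fin p) (Fin q) D.OLGAED} {Mstar : Matrix (Fin p) (Fin q) D.Alg}
    (hD : D.IsGAlgebra) (h : D.IsFractionFreeForm M Mstar) :
    ∃ t : Fin p → D.Alg, (∀ i, t i ∈ D.denominators) ∧
      ∀ i, D.mapVec q (Mstar.row i) = D.toOLGAED (t i) • M.row i := by
  obtain ⟨t, ht, h⟩ := h
  refine ⟨t, fun i => (mem_denominators_iff' hD).2 (ht i), fun i => funext fun j => ?_⟩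
  have := congrFun (congrFun h i) j
  rw [Matrix.diagonal_mul] at this
  exact this.symm

theorem span_mapVec_eq_span {p : ℕ} {M : Matrix (Fin p) (Fin q) D.OLGAED}
    {Mstar : Matrix (Fin p) (Fin q) D.Alg} (hD : D.IsGAlgebra)
    (h : D.IsFractionFreeForm M Mstar) {ι : Type*} {b : ι → Fin q → D.Alg}
    (hbL : ∀ i, b i ∈ Submodule.span D.Alg (Set.range Mstar.row))
    (hb : ∀ f ∈ Submodule.span D.Alg (Set.range Mstar.row),
      D.mapVec q f ∈ Submodule.span D.OLGAED (Set.range fun i => D.mapVec q (b i))) :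
    Submodule.span D.OLGAED (Set.range fun i => D.mapVec q (b i)) =
      Submodule.span D.OLGAED (Set.range M.row) := by
  obtain ⟨t, ht, hrow⟩ := h.exists_smul_row hD
  refine le_antisymm (Submodule.span_le.2 ?_) (Submodule.span_le.2 ?_)
  · rintro _ ⟨i, rfl⟩
    refine mapVec_mem ?_ (hbL i)
    rintro _ ⟨k, rfl⟩
    rw [hrow]
    exact Submodule.smul_mem _ _ (Submodule.subset_span ⟨k, rfl⟩)
  · rintro _ ⟨k, rfl⟩
    refine mem_of_smul_mem (ht k) ?_
    rw [← hrow]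
    exact hb _ (Submodule.subset_span ⟨k, rfl⟩)

theorem IsFractionFreeForm.linearIndependent {p : ℕ} {M : Matrix (Fin p) (Fin q) D.OLGAED}
    {Mstar : Matrix (Fin p) (Fin q) D.Alg} (hD : D.IsGAlgebra)
    (h : D.IsFractionFreeForm M Mstar) (hM : LinearIndependent D.OLGAED M.row) :
    LinearIndependent D.Alg Mstar.row := by
  have := nontrivial hD
  have := noZeroDivisors hD
  obtain ⟨t, ht, hrow⟩ := h.exists_smul_row hD
  replace hM := (Fintype.linearIndependent_iff (R := D.OLGAED) (v := M.row)).1 hM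
  rw [Fintype.linearIndependent_iff]
  intro c hc i
  have h1 := congrArg (D.mapVec q) hc
  simp only [map_sum, LinearMap.map_smulₛₗ, hrow, map_zero, smul_smul] at h1
  have h2 := hM _ h1 i
  rw [← toOLGAEDHom_apply, ← map_mul] at h2
  have h3 : c i * t i = 0 := toOLGAED_injective hD (h2.trans (map_zero D.toOLGAEDHom).symm)
  exact (mul_eq_zero.1 h3).resolve_right ((mem_denominators_iff' hD).1 (ht i)).2

/-- The span of linearly independent rows contains a nonzero multiple of each unit vector. -/
theorem exists_single_mem_span (hD : D.IsGAlgebra) {m : MonomialOrder (Fin (n + 1))}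
    (hm : D.IsAdmissible m) (hdel : DelIsLarge m) {p : ℕ} {v : Fin p → Fin p → D.Alg}
    (hv : LinearIndependent D.Alg v) (i : Fin p) :
    ∃ s : D.Alg, s ≠ 0 ∧ Pi.single i s ∈ Submodule.span D.Alg (Set.range v) := by
  have := nontrivial hD
  have := noZeroDivisors hD
  -- The unit vector and the `p` rows are `p + 1` vectors of length `p`; independence of the rows
  -- forces a nonzero coefficient at the unit vector.
  obtain ⟨c, hc, h⟩ := exists_ne_zero_sum_mul_eq_zero (exists_mul_eq_mul hD hm hdel) p
    (Fin.cons (Pi.single i 1) v)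
  have h1 : Pi.single i (c 0) + ∑ k : Fin p, c k.succ • v k = 0 := by
    funext j
    have := h j
    rw [Fin.sum_univ_succ] at this
    simpa [Pi.single_apply] using this
  refine ⟨c 0, fun h0 => hc ?_, ?_⟩
  · rw [h0, Pi.single_zero, zero_add] at h1
    funext k
    cases k using Fin.cases with
    | zero => exact h0
    | succ k => exact Fintype.linearIndependent_iff.1 hv _ h1 k
  · rw [eq_neg_of_add_eq_zero_left h1]
    exact neg_mem (sum_mem fun k _ =>
      Submodule.smul_mem _ _ (Submodule.subset_span (Set.mem_range_self k)))

end Localization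

end

end GPresentation

/-! ### The selected elements generate the row module -/

theorem mainTheorem1 {K : Type*} [Field K] {n : ℕ} (D : GPresentation K (n + 1))
    (hD : D.IsGAlgebra)
    (m : MonomialOrder (Fin (n + 1))) (hm : D.IsAdmissible m)
    (hdel : GPresentation.DelIsLarge m)
    [OreLocalization.OreSet D.denominators]
    {p : ℕ} (M : Matrix (Fin p) (Fin p) D.OLGAED)
    (hM : LinearIndependent D.OLGAED M.row)
    (Mstar : Matrix (Fin p) (Fin p) D.Alg) (hMstar : D.IsFractionFreeForm M Mstar)
    (G : Finset (Fin p → D.Alg))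
    (hG : D.IsReducedGroebnerBasis m G (Submodule.span D.Alg (Set.range Mstar.row))) :
    ∃ b : Fin p → (Fin p → D.Alg),
      (∀ i, ∀ g, D.IsSelected m G i g ↔ g = b i) ∧
      (∀ i, IsLeast (D.deg m '' D.block m G i) (D.deg m (b i))) ∧
      Submodule.span D.OLGAED (Set.range fun i => fun j => D.toOLGAED (b i j)) =
        Submodule.span D.OLGAED (Set.range M.row) ∧
      Set.range b = {g | D.IsBoxed m G g} ∧
      ∃ (l : ℕ) (B : Matrix (Fin l) (Fin p) D.Alg), D.IsBlockTriangularForm m G B ∧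
        Set.range b =
          B.row '' {r | ∀ s, D.lpos m (B.row s) = D.lpos m (B.row r) → r ≤ s} := by
  classical
  have hinj := hG.lm_injOn hD
  have hblock : ∀ i : Fin p, (G.filter fun g => D.lpos m g = i).Nonempty := by
    intro i
    obtain ⟨s, hs, hsL⟩ := GPresentation.exists_single_mem_span hD hm hdel
      (hMstar.linearIndependent hD hM) i
    obtain ⟨g, hg, -⟩ := hG.exists_mem_block hD hsL (i := i) (by simpa using hs)
      fun j hj => Pi.single_eq_of_ne hj.ne' _
    exact ⟨g, Finset.mem_filter.2 hg⟩
  choose b hb hbmin using fun i => Finset.exists_min_image _ (D.lm m) (hblock i)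
  simp only [Finset.mem_filter] at hb hbmin
  have hbG : ∀ i, b i ∈ G := fun i => (hb i).1
  have hbpos : ∀ i, D.lpos m (b i) = i := fun i => (hb i).2
  have hb0 : ∀ i, b i ≠ 0 := fun i => hG.ne_zero _ (hbG i)
  have hbdeg : ∀ i, ∀ g ∈ D.block m G i, D.deg m (b i) ≤ D.deg m g := fun i g hg =>
    GPresentation.deg_mono hD hdel (hb0 i) (hG.ne_zero _ hg.1) (hbpos i) hg.2 (hbmin i g hg)
  have huniq : ∀ i, ∀ g ∈ D.block m G i, D.lm m g ≤ D.lm m (b i) → g = b i := fun i g hg h =>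
    hinj hg.1 (hbG i) (le_antisymm h (hbmin i g hg))
  refine ⟨b, fun i g => ⟨?_, ?_⟩, fun i => ⟨⟨b i, hb i, rfl⟩, ?_⟩, ?_, ?_, ?_⟩
  · rintro ⟨a, ⟨g₀, hg₀, hmin₀, hdeg₀⟩, ⟨hg, -⟩, hmin⟩
    -- The witness for α_i is `b i` itself, so `b i` has degree α_i and takes part in the comparison
    -- with `g`.
    rw [huniq i g₀ hg₀ (hmin₀ _ (hb i))] at hdeg₀
    exact huniq i g hg (hmin _ (hb i) hdeg₀)
  · rintro rfl
    have hdeg := GPresentation.deg_of_lpos_eq hD (hb0 i) (hbpos i)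
    exact ⟨_, ⟨b i, hb i, hbmin i, hdeg⟩, ⟨hb i, hdeg⟩, fun h hh _ => hbmin i h hh⟩
  · rintro _ ⟨g, hg, rfl⟩
    exact hbdeg i g hg
  · have hb' := fun i => (GPresentation.lpos_eq_coe_iff hD (hb0 i)).1 (hbpos i)
    refine GPresentation.span_mapVec_eq_span hD hMstar (fun i => hG.subset _ (hbG i)) fun f hf =>
      GPresentation.mapVec_mem_span_of_forall hD hm hdel (fun i => hG.subset _ (hbG i))
        (fun i => (hb' i).1) (fun i => (hb' i).2) (fun f hf i hi hfi => ?_) hf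
    obtain ⟨g, hg, hgf⟩ := hG.exists_mem_block hD hf hi hfi
    have h := hbdeg i g hg
    rw [GPresentation.deg_of_lpos_eq hD (hb0 i) (hbpos i),
      GPresentation.deg_of_lpos_eq hD (hG.ne_zero _ hg.1) hg.2, Nat.cast_le] at h
    -- Divisibility of leading monomials is componentwise; only the ∂-component is needed.
    exact h.trans (hgf _)
  · ext g
    constructor
    · rintro ⟨i, rfl⟩
      exact ⟨hbG i, fun h hh hpos => hbmin i h ⟨hh, hpos.trans (hbpos i)⟩⟩
    · rintro ⟨hg, hmin⟩
      obtain ⟨i, hi⟩ := GPresentation.exists_lpos_eq_coe hD m (hG.ne_zero _ hg)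
      exact ⟨i, (huniq i g ⟨hg, hi⟩ (hmin _ (hbG i) ((hbpos i).trans hi.symm))).symm⟩
  · obtain ⟨l, B, hrange, hmono⟩ := GPresentation.exists_sorted_matrix hinj
    have hBG : ∀ r, B.row r ∈ G := fun r =>
      Finset.mem_coe.1 (hrange ▸ Set.mem_range_self r)
    have hGB : ∀ g ∈ G, ∃ r, B.row r = g := fun g hg =>
      (Set.ext_iff.1 hrange g).2 (Finset.mem_coe.2 hg)
    have hB0 : ∀ r, B.row r ≠ 0 := fun r => hG.ne_zero _ (hBG r)
    refine ⟨l, B, ⟨hrange, hmono, fun r s hrs => GPresentation.lpos_mono (hmono.monotone hrs),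
      fun i => ?_, fun r i hi => ((GPresentation.lpos_eq_coe_iff hD (hB0 r)).1 hi).1,
      fun r i j hi hij => ((GPresentation.lpos_eq_coe_iff hD (hB0 r)).1 hi).2 j hij⟩, ?_⟩
    · obtain ⟨r, hr⟩ := hGB _ (hbG i)
      exact ⟨r, hr ▸ hbpos i⟩
    · ext g
      constructor
      · rintro ⟨i, rfl⟩
        obtain ⟨r, hr⟩ := hGB _ (hbG i)
        -- Row order is the order of leading monomials, so the top row of a block is its smallest
        -- element.
        refine ⟨r, fun s hs => hmono.le_iff_le.1 ?_, hr⟩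
        rw [hr, hbpos] at hs
        simpa only [hr] using hbmin i _ ⟨hBG s, hs⟩
      · rintro ⟨r, hr, rfl⟩
        obtain ⟨i, hi⟩ := GPresentation.exists_lpos_eq_coe hD m (hB0 r)
        obtain ⟨s, hs⟩ := hGB _ (hbG i)
        have hrs := hr s (by rw [hs, hbpos, hi])
        refine ⟨i, (huniq i _ ⟨hBG r, hi⟩ ?_).symm⟩
        rw [← hs]
        exact hmono.monotone hrs
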